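/- Let $0<\gamma_1<\gamma_2<\cdots$ be the distinct positive imaginary parts of the nontrivial zeros of the Riemann zeta-function, and assume that the real numbers $\gamma_m$ are linearly independent over $\mathbb{Q}$. Put $$b_m=(\tfrac12+i\gamma_m)(\tfrac32+i\gamma_m),\qquad c_m=\frac1{|b_m|},\qquad f(\alpha)=\sum_{m}\frac{e^{i\alpha\gamma_m}}{b_m}\quad(\alpha\in\mathbb{R}),$$ write $|dw|=du\,dv/(2\pi)$ for $w=u+iv$, let $\psi_z(w)=\exp(i\,\mathrm{Re}(\overline{z}w))$ for $z,w\in\mathbb{C}$, and let $$\widetilde M(z)=\prod_{m}\frac1{2\pi}\int_0^{2\pi}\psi_z(c_me^{i\theta})\,d\theta,\qquad M(w)=\int_{\mathbb{C}}\widetilde M(z)\,\psi_{-w}(z)\,|dz| .$$ Then the series for $f(\alpha)$ converges absolutely for every $\alpha$, the product $\widetilde M(z)$ converges for every $z$, and $\widetilde M$ is integrable on $\mathbb{C}$. The function $M$ is real-valued, non-negative and continuous, $M(w)\to0$ as $|w|\to\infty$, $M(\overline w)=M(w)$ for all $w$, and $$\int_{\mathbb{C}}M(w)\,|dw|=1 .$$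 Moreover, $$\lim_{X\to\infty}\frac1X\int_0^X\Phi(f(\alpha))\,d\alpha=\int_{\mathbb{C}}M(w)\Phi(w)\,|dw|$$ (all these integrals being absolutely convergent) for every $\Phi:\mathbb{C}\to\mathbb{C}$ that is continuous, or that is the characteristic function of a compact set $A\subset\mathbb{C}$ whose topological boundary has two-dimensional Lebesgue measure zero, or of the complement of such a set. -/

import Mathlib

open Filter Topology MeasureTheory

noncomputable section

namespace GoldbachM

/-- The set `{γ₁ < γ₂ < ⋯}` of positive imaginary parts of the nontrivial zeros of the
Riemann zeta-function, each ordinate being listed once. -/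
def zetaOrdinates : Set ℝ :=
  {γ : ℝ | 0 < γ ∧ ∃ s : ℂ, riemannZeta s = 0 ∧ 0 < s.re ∧ s.re < 1 ∧ s.im = γ}

/-- `b(γ) = (1/2 + iγ)(3/2 + iγ)`. -/
def b (γ : ℝ) : ℂ := (1 / 2 + Complex.I * (γ : ℂ)) * (3 / 2 + Complex.I * (γ : ℂ))

/-- `c(γ) = 1 / |b(γ)|`. -/
def c (γ : ℝ) : ℝ := 1 / ‖b γ‖

/-- The term `e^{iαγ} / b(γ)`. -/
def fTerm (α γ : ℝ) : ℂ := Complex.exp (Complex.I * (α : ℂ) * (γ : ℂ)) / b γ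

/-- `f(α) = ∑_γ e^{iαγ} / b(γ)`, over the positive ordinates of the nontrivial zeros. -/
def f (α : ℝ) : ℂ := ∑' γ : zetaOrdinates, fTerm α γ

/-- The measure `|dw| = du dv / (2π)` on `ℂ`, for `w = u + iv`. -/
def dw : Measure ℂ := ENNReal.ofReal (1 / (2 * Real.pi)) • (volume : Measure ℂ)

/-- The character `ψ_z(w) = exp(i Re(conj z · w))`. -/
def psi (z w : ℂ) : ℂ :=
  Complex.exp (Complex.I * (((starRingEnd ℂ z * w).re : ℝ) : ℂ))

/-- `(2π)⁻¹ ∫₀^{2π} ψ_z(r e^{iθ}) dθ`, the Fourier transform of the uniform distribution on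
the circle of radius `r` centred at `0`. -/
def circleFourier (r : ℝ) (z : ℂ) : ℂ :=
  (1 / (2 * Real.pi) : ℂ) *
    ∫ θ in (0 : ℝ)..(2 * Real.pi), psi z ((r : ℂ) * Complex.exp (Complex.I * (θ : ℂ)))

/-- `M̃(z)`, the product over all `γ` of the transforms for the radii `c(γ)`. -/
def MTilde (z : ℂ) : ℂ := ∏' γ : zetaOrdinates, circleFourier (c γ) z

/-- The inverse Fourier transform `∫ M̃(z) ψ_{-w}(z) |dz|`. -/
def MInt (w : ℂ) : ℂ := ∫ z, MTilde z * psi (-w) z ∂dw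

/-- The test functions: continuous functions, and characteristic functions of compact sets
with Lebesgue-null boundary and of their complements. -/
def IsTestFunction (Φ : ℂ → ℂ) : Prop :=
  Continuous Φ ∨
    ∃ A : Set ℂ, IsCompact A ∧ volume (frontier A) = 0 ∧
      (Φ = A.indicator (fun _ => (1 : ℂ)) ∨ Φ = Aᶜ.indicator (fun _ => (1 : ℂ)))

end GoldbachM

end

namespace GoldbachM

open Complex HurwitzZeta Set

/-! ### The entire function `s (1 - s) Λ(s)` -/

/-! The function `M` is 2π times the density of the limiting distribution of `f(α)`, and `M̃` is the
characteristic function of that distribution. Truncate the series for `f` to finitely many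
ordinates. Linear independence and Kronecker–Weyl make the phases equidistribute on a torus, so the
time mean of `ψ_z` along the truncation tends to a product of circle transforms. As `∑ c(γ)`
converges, truncation is uniform in `α`, and the mean of `ψ_z(f(α))` tends to `M̃(z)`
(`tendsto_timeMean_psi_f`).

Two facts about zeta are needed. Summability of `c` (`summable_c`) needs that the zeros are not too
dense: `xi` has growth of order at most 3/2, and Jensen's inequality counts its zeros. Integrability
of `M̃` needs enough decaying factors, hence sufficiently many ordinates; they are infinite in
number (`infinite_zetaOrdinates`), because an entire function with finitely many zeros and order
below 2 is at most of exponential type, while `xi` grows factorially at even integers. Nine factors,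
each `O(|z|^(-1/3))`, give decay `|z|^(-3)`, integrable in the plane.

That the Fourier transform of `M̃` is nonnegative and compactly supported is not visible from the
product. It is read off from time means: these converge for Schwartz functions by Fourier inversion,
and the density at `w` is a limit of such means for bumps shrinking to `w`
(`density_mem_of_timeMean_mem`). Compact support makes the density integrable, so Fourier inversion
identifies its characteristic function as `M̃`. Lévy's continuity theorem then gives weak
convergence (`tendsto_lawProb`); unbounded continuous test functions reduce to bounded ones because
`f` is bounded, and sets with null boundary follow from the portmanteau theorem. -/

/-- The kernel whose Mellin transform is the entire part of the completed zeta function. -/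
noncomputable def zetaKernel : ℝ → ℂ := (hurwitzEvenFEPair 0).f_modif

lemma one_le_evenKernel_zero {t : ℝ} (ht : 0 < t) : 1 ≤ evenKernel 0 t := by
  have h := hasSum_int_evenKernel₀ 0 ht
  have h0 : 0 ≤ evenKernel ((0 : ℝ) : UnitAddCircle) t -
      if ((0 : ℝ) : UnitAddCircle) = 0 then 1 else 0 :=
    h.nonneg fun n => by split_ifs <;> positivity
  simpa using h0

/-- The theta function is at least 1. Above 1 the kernel is theta minus 1; below 1 it is theta minus
`t^(-1/2)`, which the functional equation reduces to the first case. Positivity makes the Mellin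
transform largest, on each vertical line, at the real point. -/
lemma zetaKernel_eq_norm {t : ℝ} (ht : 0 < t) : zetaKernel t = (‖zetaKernel t‖ : ℝ) := by
  suffices h : ∃ r : ℝ, 0 ≤ r ∧ zetaKernel t = r by
    obtain ⟨r, hr, h⟩ := h
    rw [h, norm_real, Real.norm_of_nonneg hr]
  simp only [zetaKernel, WeakFEPair.f_modif, Pi.add_apply]
  rcases lt_trichotomy t 1 with h | rfl | h
  · rw [indicator_of_notMem (by simpa using h.le),
      indicator_of_mem (show t ∈ Ioo (0 : ℝ) 1 from ⟨ht, h⟩)]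
    refine ⟨evenKernel 0 t - t ^ (-(1 / 2) : ℝ), ?_, ?_⟩
    · have h2 := evenKernel_functional_equation 0 t
      have h3 := one_le_evenKernel_zero (t := 1 / t) (by positivity)
      rw [h2, ← evenKernel_eq_cosKernel_of_zero, Real.rpow_neg ht.le, one_div (t ^ _)]
      have : 0 ≤ (t ^ (1 / 2 : ℝ))⁻¹ := by positivity
      nlinarith
    · simp [hurwitzEvenFEPair]
  · exact ⟨0, le_rfl, by simp⟩
  · rw [indicator_of_mem (by simpa using h), indicator_of_notMem (by simp [h.le])]
    refine ⟨evenKernel 0 t - 1, by linarith [one_le_evenKernel_zero ht], ?_⟩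
    simp [hurwitzEvenFEPair]

lemma mellinConvergent_zetaKernel (s : ℂ) : MellinConvergent zetaKernel s :=
  ((hurwitzEvenFEPair 0).isStrongFEPair_toStrongFEPair.hasMellin s).1

lemma completedRiemannZeta₀_eq_mellin (s : ℂ) :
    completedRiemannZeta₀ s = mellin zetaKernel (s / 2) / 2 := rfl

/-- The Mellin transform of `|zetaKernel|` at a real point. -/
noncomputable def zetaKernelMoment (σ : ℝ) : ℝ := ∫ t in Ioi (0 : ℝ), t ^ (σ - 1) * ‖zetaKernel t‖

lemma norm_mellin_integrand {t : ℝ} (ht : 0 < t) (s : ℂ) :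
    ‖(t : ℂ) ^ (s - 1) • zetaKernel t‖ = t ^ (s.re - 1) * ‖zetaKernel t‖ := by
  rw [norm_smul, norm_cpow_eq_rpow_re_of_pos ht]; simp

lemma integrableOn_zetaKernelMoment (σ : ℝ) :
    IntegrableOn (fun t : ℝ => t ^ (σ - 1) * ‖zetaKernel t‖) (Ioi 0) := by
  have h : IntegrableOn _ (Ioi (0 : ℝ)) := (mellinConvergent_zetaKernel σ).norm
  refine h.congr_fun (fun t ht => ?_) measurableSet_Ioi
  simpa using norm_mellin_integrand (mem_Ioi.1 ht) σ

lemma norm_mellin_zetaKernel_le (s : ℂ) : ‖mellin zetaKernel s‖ ≤ zetaKernelMoment s.re := by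
  refine (norm_integral_le_integral_norm _).trans_eq ?_
  exact setIntegral_congr_fun measurableSet_Ioi fun t ht => norm_mellin_integrand ht s

lemma mellin_zetaKernel_ofReal (σ : ℝ) : mellin zetaKernel σ = zetaKernelMoment σ := by
  rw [zetaKernelMoment, ← integral_complex_ofReal]
  refine setIntegral_congr_fun measurableSet_Ioi fun t ht => ?_
  have h := zetaKernel_eq_norm (mem_Ioi.1 ht)
  simp only [smul_eq_mul]
  rw [h]
  push_cast
  rw [ofReal_cpow (mem_Ioi.1 ht).le]
  simp

lemma zetaKernelMoment_nonneg (σ : ℝ) : 0 ≤ zetaKernelMoment σ :=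
  setIntegral_nonneg measurableSet_Ioi fun _ ht =>
    mul_nonneg (Real.rpow_nonneg (mem_Ioi.1 ht).le _) (norm_nonneg _)

lemma zetaKernelMoment_le_add {σ a b : ℝ} (ha : a ≤ σ) (hb : σ ≤ b) :
    zetaKernelMoment σ ≤ zetaKernelMoment a + zetaKernelMoment b := by
  simp only [zetaKernelMoment]
  rw [← integral_add (integrableOn_zetaKernelMoment a) (integrableOn_zetaKernelMoment b)]
  refine setIntegral_mono_on (integrableOn_zetaKernelMoment σ)
    ((integrableOn_zetaKernelMoment a).add (integrableOn_zetaKernelMoment b)) measurableSet_Ioi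
    fun t ht => ?_
  have ht' : (0 : ℝ) < t := ht
  rw [← add_mul]
  gcongr
  have h1 := Real.rpow_nonneg ht'.le (a - 1)
  have h2 := Real.rpow_nonneg ht'.le (b - 1)
  rcases le_total t 1 with h | h
  · have := Real.rpow_le_rpow_of_exponent_ge ht' h (sub_le_sub_right ha 1)
    linarith
  · have := Real.rpow_le_rpow_of_exponent_le h (sub_le_sub_right hb 1)
    linarith

/-- On a strip the moment is at most the sum of the two edge moments, which coincide by the
functional equation. Growth in the whole plane thus reduces to real points, and Stirling's formula
is avoided. -/
lemma norm_completedRiemannZeta₀_le {s : ℂ} {N : ℝ} (h1 : 1 - N ≤ s.re) (h2 : s.re ≤ N) :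
    ‖completedRiemannZeta₀ s‖ ≤ 2 * ‖completedRiemannZeta₀ N‖ := by
  have key (σ : ℝ) : ‖completedRiemannZeta₀ σ‖ = zetaKernelMoment (σ / 2) / 2 := by
    rw [completedRiemannZeta₀_eq_mellin, ← ofReal_ofNat, ← ofReal_div, mellin_zetaKernel_ofReal,
      ← ofReal_div, norm_real, Real.norm_of_nonneg (by have := zetaKernelMoment_nonneg (σ / 2); positivity)]
  have hsym : ‖completedRiemannZeta₀ ((1 - N : ℝ) : ℂ)‖ = ‖completedRiemannZeta₀ N‖ := by
    push_cast; rw [completedRiemannZeta₀_one_sub]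
  have h3 := zetaKernelMoment_le_add (σ := s.re / 2) (a := (1 - N) / 2) (b := N / 2)
    (by linarith) (by linarith)
  have h4 : ‖completedRiemannZeta₀ s‖ ≤ zetaKernelMoment (s.re / 2) / 2 := by
    rw [completedRiemannZeta₀_eq_mellin, norm_div, norm_ofNat]
    gcongr
    simpa using norm_mellin_zetaKernel_le (s / 2)
  have e1 := key (1 - N)
  have e2 := key N
  rw [hsym] at e1
  linarith

/-- `s (1 - s) Λ(s)`, as an entire function. -/
noncomputable def xi (s : ℂ) : ℂ := s * (1 - s) * completedRiemannZeta₀ s - 1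

lemma differentiable_xi : Differentiable ℂ xi := by
  have := differentiable_completedZeta₀
  unfold xi
  fun_prop

lemma xi_zero : xi 0 = -1 := by simp [xi]

lemma xi_one : xi 1 = -1 := by simp [xi]

lemma xi_one_sub (s : ℂ) : xi (1 - s) = xi s := by
  simp only [xi, completedRiemannZeta₀_one_sub]; ring

lemma xi_eq {s : ℂ} (h0 : s ≠ 0) (h1 : s ≠ 1) :
    xi s = s * (1 - s) * completedRiemannZeta s := by
  have : 1 - s ≠ 0 := sub_ne_zero.2 h1.symm
  rw [xi, completedRiemannZeta_eq]; field_simp; ring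

lemma xi_eq_mul_riemannZeta {s : ℂ} (h0 : 0 < s.re) (h1 : s ≠ 1) :
    xi s = s * (1 - s) * (Gammaℝ s * riemannZeta s) := by
  have hs : s ≠ 0 := fun h => by simp [h] at h0
  rw [xi_eq hs h1, riemannZeta_def_of_ne_zero hs, mul_div_cancel₀ _ (Gammaℝ_ne_zero_of_re_pos h0)]

lemma xi_ne_zero_of_one_le_re {s : ℂ} (hs : 1 ≤ s.re) : xi s ≠ 0 := by
  rcases eq_or_ne s 1 with rfl | h1
  · simp [xi_one]
  have h0 : 0 < s.re := by linarith
  rw [xi_eq_mul_riemannZeta h0 h1]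
  have hs0 : s ≠ 0 := fun h => by simp [h] at h0
  have := Gammaℝ_ne_zero_of_re_pos h0
  have := riemannZeta_ne_zero_of_one_le_re hs
  have : 1 - s ≠ 0 := sub_ne_zero.2 h1.symm
  positivity

lemma xi_eq_zero_iff (s : ℂ) : xi s = 0 ↔ riemannZeta s = 0 ∧ 0 < s.re ∧ s.re < 1 := by
  constructor
  · intro h
    have h1 : s.re < 1 := by
      by_contra! h1
      exact xi_ne_zero_of_one_le_re h1 h
    have h0 : 0 < s.re := by
      by_contra! h0
      exact xi_ne_zero_of_one_le_re (s := 1 - s) (by simpa using h0) (by rw [xi_one_sub, h])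
    have hs1 : s ≠ 1 := fun h => by simp [h] at h1
    have hs0 : s ≠ 0 := fun h => by simp [h] at h0
    rw [xi_eq_mul_riemannZeta h0 hs1] at h
    have := Gammaℝ_ne_zero_of_re_pos h0
    have : 1 - s ≠ 0 := sub_ne_zero.2 hs1.symm
    simp_all
  · rintro ⟨h, h0, h1⟩
    have hs1 : s ≠ 1 := fun h => by simp [h] at h1
    rw [xi_eq_mul_riemannZeta h0 hs1, h]; simp

/-! ### Values at even integers and growth -/

lemma riemannZeta_natCast_eq {k : ℕ} (hk : 1 < k) :
    riemannZeta k = ((∑' n : ℕ, 1 / (n : ℝ) ^ k : ℝ) : ℂ) := by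
  rw [zeta_nat_eq_tsum_of_gt_one hk]; push_cast; rfl

lemma one_le_norm_riemannZeta_natCast {k : ℕ} (hk : 1 < k) : 1 ≤ ‖riemannZeta k‖ := by
  rw [riemannZeta_natCast_eq hk, norm_real]
  refine le_trans ?_ (Real.le_norm_self _)
  have hs : Summable fun n : ℕ => 1 / (n : ℝ) ^ k := Real.summable_one_div_nat_pow.2 hk
  simpa using hs.le_tsum 1 fun n _ => by positivity

lemma norm_riemannZeta_natCast_le {k : ℕ} (hk : 2 ≤ k) : ‖riemannZeta k‖ ≤ 2 := by
  rw [riemannZeta_natCast_eq (by omega), norm_real,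
    Real.norm_of_nonneg (tsum_nonneg fun n => by positivity)]
  have h2 : ∑' n : ℕ, 1 / (n : ℝ) ^ 2 ≤ 2 := by
    rw [hasSum_zeta_two.tsum_eq]; nlinarith [Real.pi_lt_d2, Real.pi_pos]
  refine le_trans ?_ h2
  refine Summable.tsum_le_tsum (fun n => ?_) (Real.summable_one_div_nat_pow.2 (by omega))
    (Real.summable_one_div_nat_pow.2 (by omega))
  rcases Nat.eq_zero_or_pos n with rfl | hn
  · simp [show k ≠ 0 by omega]
  · have : (1 : ℝ) ≤ n := by exact_mod_cast hn
    gcongr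

lemma norm_Gammaℝ_two_mul_succ (n : ℕ) :
    ‖Gammaℝ ((2 * (n + 1) : ℕ) : ℂ)‖ = (Real.pi ^ (n + 1))⁻¹ * n.factorial := by
  rw [Gammaℝ_def]
  have h1 : ((2 * (n + 1) : ℕ) : ℂ) / 2 = (n : ℂ) + 1 := by push_cast; ring
  have h2 : -((2 * (n + 1) : ℕ) : ℂ) / 2 = -((n + 1 : ℕ) : ℂ) := by push_cast; ring
  rw [h1, h2, Gamma_nat_eq_factorial, cpow_neg, cpow_natCast, norm_mul, norm_inv, norm_pow,
    norm_real, Real.norm_of_nonneg Real.pi_pos.le]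
  simp

lemma xi_even_lower_bound (n : ℕ) :
    (Real.pi ^ (n + 1))⁻¹ * n.factorial ≤ ‖xi ((2 * (n + 1) : ℕ) : ℂ)‖ := by
  have hne : ((2 * (n + 1) : ℕ) : ℂ) ≠ 1 := by
    have : 2 * (n + 1) ≠ 1 := by omega
    exact_mod_cast this
  rw [xi_eq_mul_riemannZeta (by simp; positivity) hne, norm_mul, norm_mul, norm_mul,
    norm_Gammaℝ_two_mul_succ]
  have h1 : 1 ≤ ‖((2 * (n + 1) : ℕ) : ℂ)‖ := by
    rw [norm_natCast]; exact_mod_cast (by omega)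
  have h2 : 1 ≤ ‖1 - ((2 * (n + 1) : ℕ) : ℂ)‖ := by
    rw [norm_sub_rev]
    have : ((2 * (n + 1) : ℕ) : ℂ) - 1 = ((2 * n + 1 : ℕ) : ℂ) := by push_cast; ring
    rw [this, norm_natCast]; exact_mod_cast (by omega)
  have h3 := one_le_norm_riemannZeta_natCast (k := 2 * (n + 1)) (by omega)
  have h4 : 0 ≤ (Real.pi ^ (n + 1))⁻¹ * n.factorial := by positivity
  have h5 := one_le_mul_of_one_le_of_one_le h1 h2
  calc _ = 1 * ((Real.pi ^ (n + 1))⁻¹ * n.factorial * 1) := by ring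
    _ ≤ _ := by gcongr

lemma norm_completedRiemannZeta₀_even_le (n : ℕ) :
    ‖completedRiemannZeta₀ ((2 * (n + 1) : ℕ) : ℂ)‖ ≤ 2 * n.factorial + 2 := by
  set N : ℕ := 2 * (n + 1) with hN
  have hN0 : (N : ℂ) ≠ 0 := by exact_mod_cast (by omega : N ≠ 0)
  have e1 : completedRiemannZeta₀ N = Gammaℝ N * riemannZeta N + 1 / N + 1 / (1 - N) := by
    rw [riemannZeta_def_of_ne_zero hN0,
      mul_div_cancel₀ _ (Gammaℝ_ne_zero_of_re_pos (by simp; omega)), completedRiemannZeta_eq]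
    ring
  have h1 : ‖(1 : ℂ) / N‖ ≤ 1 := by
    rw [norm_div, norm_one, norm_natCast]
    exact div_le_one_of_le₀ (by exact_mod_cast (by omega)) (by positivity)
  have h2 : ‖(1 : ℂ) / (1 - N)‖ ≤ 1 := by
    have : (1 : ℂ) - N = -((2 * n + 1 : ℕ) : ℂ) := by rw [hN]; push_cast; ring
    rw [this, norm_div, norm_one, norm_neg, norm_natCast]
    exact div_le_one_of_le₀ (by exact_mod_cast (by omega)) (by positivity)
  have h3 : ‖Gammaℝ N * riemannZeta N‖ ≤ 2 * n.factorial := by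
    rw [norm_mul, norm_Gammaℝ_two_mul_succ, mul_comm 2]
    gcongr
    · have : 1 ≤ Real.pi ^ (n + 1) := one_le_pow₀ (by linarith [Real.pi_gt_three])
      exact mul_le_of_le_one_left (by positivity) (inv_le_one_of_one_le₀ this)
    · exact norm_riemannZeta_natCast_le (by omega)
  rw [e1]
  calc _ ≤ ‖Gammaℝ N * riemannZeta N‖ + ‖(1 : ℂ) / N‖ + ‖(1 : ℂ) / (1 - N)‖ := norm_add₃_le
    _ ≤ _ := by linarith

/-- `xi` has growth of order at most `3/2`. -/
lemma exists_norm_xi_le :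
    ∃ C : ℝ, 0 < C ∧ ∀ s : ℂ, ‖xi s‖ ≤ Real.exp (C * ((1 + ‖s‖) * √(1 + ‖s‖))) := by
  refine ⟨10, by norm_num, fun s => ?_⟩
  set R := 1 + ‖s‖ with hR
  have hR1 : 1 ≤ R := by have := norm_nonneg s; linarith
  -- The strip with `N = 2 (n + 1)` contains `s`, and at this even integer the Gamma factor is a
  -- factorial over a power of π.
  set n := ⌊R⌋₊ with hn
  have hn1 : (n : ℝ) ≤ R := Nat.floor_le (by linarith)
  have hn2 : R < n + 1 := Nat.lt_floor_add_one R
  have hre := abs_re_le_norm s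
  have hre' := abs_le.1 hre
  have b1 : ‖completedRiemannZeta₀ s‖ ≤ 2 * (2 * n.factorial + 2) := by
    refine (norm_completedRiemannZeta₀_le (s := s) (N := (2 * (n + 1) : ℕ)) ?_ ?_).trans ?_
    · push_cast; linarith
    · push_cast; linarith
    · have := norm_completedRiemannZeta₀_even_le n
      push_cast at this ⊢
      linarith
  have b2 : ‖xi s‖ ≤ R * R * (2 * (2 * n.factorial + 2)) + 1 := by
    unfold xi
    refine (norm_sub_le _ _).trans ?_
    rw [norm_one, norm_mul, norm_mul]
    gcongr
    · linarith
    · exact (norm_sub_le _ _).trans (by simp [hR])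
  have b3 : (n.factorial : ℝ) ≤ R ^ n := by
    calc (n.factorial : ℝ) ≤ (n : ℝ) ^ n := by exact_mod_cast Nat.factorial_le_pow n
      _ ≤ _ := by gcongr
  have b4 : 1 ≤ R ^ n := one_le_pow₀ hR1
  set q := √R with hq
  have hq1 : 1 ≤ q := Real.one_le_sqrt.2 hR1
  have hqq : q * q = R := Real.mul_self_sqrt (by linarith)
  -- This crude bound replaces `log R` by `2√R`, turning `R ^ n` with `n ≤ R` into an exponent of
  -- order `R^(3/2)`. Any order below 2 would serve.
  have b5 : R ≤ Real.exp (2 * q) := by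
    have := Real.add_one_le_exp q
    calc R = q * q := hqq.symm
      _ ≤ Real.exp q * Real.exp q := by gcongr <;> linarith
      _ = _ := by rw [← Real.exp_add]; ring_nf
  have b6 : ‖xi s‖ ≤ 9 * (R * R * R ^ n) := by
    have : 1 ≤ R * R * R ^ n := by
      have := one_le_mul_of_one_le_of_one_le hR1 hR1
      exact one_le_mul_of_one_le_of_one_le this b4
    have h2 : R * R * (2 * (2 * n.factorial + 2)) ≤ R * R * (8 * R ^ n) := by
      apply mul_le_mul_of_nonneg_left _ (by positivity); linarith
    linarith
  have b7 : (9 : ℝ) ≤ Real.exp 4 := by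
    have := Real.add_one_le_exp 2
    have h2 : Real.exp 4 = Real.exp 2 * Real.exp 2 := by rw [← Real.exp_add]; norm_num
    nlinarith
  calc ‖xi s‖ ≤ 9 * (R * R * R ^ n) := b6
    _ ≤ Real.exp 4 * (Real.exp (2 * q) * Real.exp (2 * q) * Real.exp (2 * q) ^ n) := by gcongr
    _ = Real.exp (4 + 4 * q + n * (2 * q)) := by
      rw [← Real.exp_nat_mul, ← Real.exp_add, ← Real.exp_add, ← Real.exp_add]; ring_nf
    _ ≤ Real.exp (10 * (R * q)) := by
      apply Real.exp_le_exp.2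
      have : n * q ≤ R * q := by gcongr
      have h2 : 1 * q ≤ R * q := by gcongr
      linarith

end GoldbachM

namespace GoldbachM

open Complex Set Metric

/-! ### Counting zeros -/

/-- Jensen's inequality on the discs of radii `r` and `3 * r`, with multiplicities discarded. -/
lemma card_zeros_le {F : ℂ → ℂ} (hF : Differentiable ℂ F) (h0 : F 0 ≠ 0) {r M : ℝ} (hr : 0 < r)
    (hM : 1 ≤ M) (hb : ∀ z : ℂ, ‖z‖ = 3 * r → ‖F z‖ ≤ M) (S : Finset ℂ)
    (hS : ∀ z ∈ S, F z = 0 ∧ ‖z‖ ≤ r) :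
    (S.card : ℝ) ≤ Real.log (M / ‖F 0‖) / Real.log 3 := by
  have hA (U : Set ℂ) : AnalyticOnNhd ℂ F U := fun z _ => hF.analyticAt z
  have h := AnalyticOnNhd.sum_divisor_le (c := 0) (r := r) (R := 3 * r) (M := M) (f := F)
    (by positivity) (by rw [abs_of_pos hr, abs_of_pos (by positivity)]; linarith) hM (hA _) h0
    (fun z hz => hb z (by simpa [abs_of_pos hr] using hz))
  rw [mul_div_assoc, div_self hr.ne', mul_one] at h
  refine le_trans ?_ h
  rw [abs_of_pos hr]
  have hfin : (Function.support (MeromorphicOn.divisor F (closedBall 0 r))).Finite :=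
    (MeromorphicOn.divisor F (closedBall 0 r)).finiteSupport (isCompact_closedBall _ _)
  have hone : ∀ z ∈ S, 1 ≤ MeromorphicOn.divisor F (closedBall 0 r) z := by
    intro z hz
    rw [MeromorphicOn.AnalyticOnNhd.divisor_apply (hA _) (by simpa using (hS z hz).2)]
    -- Infinite order would force `F` to vanish identically, against `F 0 ≠ 0`; a zero of finite
    -- order contributes at least 1 to the divisor.
    have hne : analyticOrderAt F z ≠ ⊤ := by
      rw [Ne, analyticOrderAt_eq_top]
      intro he
      exact h0 ((hA univ).eqOn_zero_of_preconnected_of_eventuallyEq_zero isPreconnected_univ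
        (mem_univ z) he (mem_univ 0))
    obtain ⟨n, hn⟩ := ENat.ne_top_iff_exists.1 hne
    have hn0 : n ≠ 0 := by
      rintro rfl
      have := (hF.analyticAt z).analyticOrderAt_eq_zero.1 hn.symm
      exact this (hS z hz).1
    rw [← hn]
    have : ((ENat.map Nat.cast (n : ℕ∞) : WithTop ℤ)).untop₀ = (n : ℤ) := rfl
    rw [this]
    exact_mod_cast Nat.one_le_iff_ne_zero.2 hn0
  have hsub : S ⊆ hfin.toFinset := fun z hz => by
    simp only [Set.Finite.mem_toFinset, Function.mem_support]
    have := hone z hz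
    omega
  rw [finsum_eq_sum_of_support_subset _ (s := hfin.toFinset) (by simp)]
  have h1 : (S.card : ℤ) ≤ ∑ z ∈ hfin.toFinset, MeromorphicOn.divisor F (closedBall 0 r) z := by
    calc (S.card : ℤ) = ∑ _z ∈ S, 1 := by simp
      _ ≤ ∑ z ∈ S, MeromorphicOn.divisor F (closedBall 0 r) z := Finset.sum_le_sum hone
      _ ≤ _ := Finset.sum_le_sum_of_subset_of_nonneg hsub fun z _ _ =>
        MeromorphicOn.AnalyticOnNhd.divisor_nonneg (hA _) z
  exact_mod_cast h1

lemma exists_card_xi_zeros_le :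
    ∃ K : ℝ, 0 < K ∧ ∀ r : ℝ, 1 ≤ r → ∀ S : Finset ℂ, (∀ z ∈ S, xi z = 0 ∧ ‖z‖ ≤ r) →
      (S.card : ℝ) ≤ K * (r * √r) := by
  obtain ⟨C, hC, hxi⟩ := exists_norm_xi_le
  refine ⟨8 * C, by positivity, fun r hr S hS => ?_⟩
  have hx0 : ‖xi 0‖ = 1 := by simp [xi_zero]
  have h := card_zeros_le differentiable_xi (by simp [xi_zero]) (r := r) (by linarith)
    (M := Real.exp (C * ((1 + 3 * r) * √(1 + 3 * r)))) (Real.one_le_exp (by positivity))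
    (fun z hz => by simpa [hz] using hxi z) S hS
  rw [hx0, div_one, Real.log_exp] at h
  have hlog : 1 ≤ Real.log 3 := by
    rw [Real.le_log_iff_exp_le (by norm_num)]; linarith [Real.exp_one_lt_d9]
  have hs : √(1 + 3 * r) ≤ 2 * √r := by
    rw [Real.sqrt_le_left (by positivity), mul_pow, Real.sq_sqrt (by linarith)]; linarith
  calc (S.card : ℝ) ≤ C * ((1 + 3 * r) * √(1 + 3 * r)) / Real.log 3 := h
    _ ≤ C * ((1 + 3 * r) * √(1 + 3 * r)) := div_le_self (by positivity) hlog
    _ ≤ C * ((4 * r) * (2 * √r)) := by gcongr; linarith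
    _ = _ := by ring

/-! ### Convergence of the sum of the radii -/

/-- Split into blocks `4^n ≤ u < 4^(n+1)`. A block has at most `K * 8^(n+1)` members, each
contributing at most `16^(-n)`, so the block sums are geometric. Base 4 keeps the square root exact.
-/
lemma summable_inv_sq_of_card_le {ι : Type*} {u : ι → ℝ} (hu : ∀ i, 1 ≤ u i) {K : ℝ}
    (hcard : ∀ r : ℝ, 1 ≤ r → ∀ S : Finset ι, (∀ i ∈ S, u i ≤ r) → (S.card : ℝ) ≤ K * (r * √r)) :
    Summable fun i => 1 / u i ^ 2 := by
  classical
  choose k hk1 hk2 using fun i => exists_nat_pow_near (hu i) (show (1 : ℝ) < 4 by norm_num)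
  have hgeom : Summable fun n : ℕ => 8 * K * (1 / 2 : ℝ) ^ n :=
    (summable_geometric_of_lt_one (by norm_num) (by norm_num)).mul_left _
  have hK : 0 ≤ K := by simpa using hcard 1 le_rfl ∅ (by simp)
  refine summable_of_sum_le (c := ∑' n : ℕ, 8 * K * (1 / 2 : ℝ) ^ n) (fun i => by positivity)
    fun S => ?_
  rw [← Finset.sum_fiberwise_of_maps_to (s := S) (t := S.image k) (g := k)
    fun i hi => Finset.mem_image_of_mem k hi]
  refine le_trans (Finset.sum_le_sum fun n _ => ?_)
    (hgeom.sum_le_tsum (S.image k) fun n _ => by positivity)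
  have h1 : ∀ i ∈ S.filter (fun i => k i = n), 1 / u i ^ 2 ≤ 1 / 16 ^ n := by
    intro i hi
    have hi' := (Finset.mem_filter.1 hi).2
    have : (4 : ℝ) ^ n ≤ u i := hi' ▸ hk1 i
    rw [show (16 : ℝ) ^ n = (4 ^ n) ^ 2 by rw [← pow_mul, mul_comm, pow_mul]; norm_num]
    gcongr
  have h2 := hcard (4 ^ (n + 1)) (one_le_pow₀ (by norm_num)) (S.filter (fun i => k i = n))
    fun i hi => by
      have hi' := (Finset.mem_filter.1 hi).2
      exact (hi' ▸ hk2 i).le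
  have h3 : √((4 : ℝ) ^ (n + 1)) = 2 ^ (n + 1) := by
    rw [Real.sqrt_eq_iff_mul_self_eq (by positivity) (by positivity), ← mul_pow]; norm_num
  rw [h3] at h2
  calc _ ≤ ∑ i ∈ S.filter (fun i => k i = n), (1 : ℝ) / 16 ^ n := Finset.sum_le_sum h1
    _ = ((S.filter (fun i => k i = n)).card : ℝ) * (1 / 16 ^ n) := by simp
    _ ≤ K * (4 ^ (n + 1) * 2 ^ (n + 1)) * (1 / 16 ^ n) := by gcongr
    _ = 8 * K * (1 / 2) ^ n := by
      rw [← mul_pow, show (16 : ℝ) = 8 * 2 by norm_num, mul_pow 8 2 n, one_div_pow,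
        show (4 * 2 : ℝ) = 8 by norm_num, pow_succ]
      field_simp

lemma zetaOrdinates_exists_xi (γ : zetaOrdinates) : ∃ s : ℂ, xi s = 0 ∧ ‖s‖ ≤ 1 + γ ∧ s.im = γ := by
  obtain ⟨γ, hγ, s, hs, h0, h1, rfl⟩ := γ
  refine ⟨s, (xi_eq_zero_iff s).2 ⟨hs, h0, h1⟩, ?_, rfl⟩
  refine (norm_le_abs_re_add_abs_im s).trans ?_
  rw [abs_of_pos h0, abs_of_pos hγ]
  simpa using h1.le

lemma b_ne_zero (γ : ℝ) : b γ ≠ 0 := by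
  unfold b
  refine mul_ne_zero (fun h => ?_) fun h => ?_
  · simpa using congrArg re h
  · simpa using congrArg re h

lemma c_pos (γ : ℝ) : 0 < c γ := one_div_pos.2 (norm_pos_iff.2 (b_ne_zero γ))

lemma c_le {γ : ℝ} (hγ : 0 < γ) : c γ ≤ 8 * (1 / (1 + γ) ^ 2) := by
  have h1 : 1 / 4 + γ ^ 2 ≤ ‖b γ‖ := by
    have e1 : ‖(1 / 2 + I * (γ : ℂ))‖ ^ 2 = 1 / 4 + γ ^ 2 := by
      rw [Complex.sq_norm, normSq_apply]; simp; ring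
    have e2 : ‖(3 / 2 + I * (γ : ℂ))‖ ^ 2 = 9 / 4 + γ ^ 2 := by
      rw [Complex.sq_norm, normSq_apply]; simp; ring
    rw [b, norm_mul]
    refine abs_le_of_sq_le_sq' ?_ (by positivity) |>.2
    rw [mul_pow, e1, e2]
    nlinarith [sq_nonneg γ]
  rw [c, ← mul_div_assoc, mul_one,
    div_le_div_iff₀ (norm_pos_iff.2 (b_ne_zero γ)) (by positivity)]
  nlinarith [sq_nonneg (γ - 1)]

lemma summable_c : Summable fun γ : zetaOrdinates => c γ := by
  classical
  obtain ⟨K, hK, hcard⟩ := exists_card_xi_zeros_le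
  choose ρ hρ0 hρ1 hρ2 using zetaOrdinates_exists_xi
  have hinj : Function.Injective ρ := fun γ γ' h => Subtype.ext (by rw [← hρ2, ← hρ2, h])
  have h : Summable fun γ : zetaOrdinates => 1 / (1 + (γ : ℝ)) ^ 2 := by
    refine summable_inv_sq_of_card_le (u := fun γ : zetaOrdinates => 1 + (γ : ℝ)) (K := K)
      (fun γ => by linarith [γ.2.1]) fun r hr S hS => ?_
    rw [← Finset.card_image_of_injective S hinj]
    refine hcard r hr _ fun z hz => ?_
    obtain ⟨γ, hγ, rfl⟩ := Finset.mem_image.1 hz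
    exact ⟨hρ0 γ, (hρ1 γ).trans (hS γ hγ)⟩
  exact Summable.of_nonneg_of_le (fun γ => (c_pos γ).le) (fun γ => c_le γ.2.1) (h.mul_left 8)

/-! ### Entire functions with finitely many zeros -/

/-- Zeros are divided out one at a time, each to its full order. Of the polynomial `P` only two
properties matter later: exponential growth at most, and modulus at least 1 far out. -/
lemma exists_factorization_of_finite_zeros (S : Finset ℂ) :
    ∀ F : ℂ → ℂ, Differentiable ℂ F → (∀ z, F z = 0 ↔ z ∈ S) →
    ∃ P G : ℂ → ℂ, Differentiable ℂ G ∧ (∀ z, G z ≠ 0) ∧ (∀ z, F z = P z * G z) ∧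
      (∃ A : ℝ, 0 ≤ A ∧ ∀ z, ‖P z‖ ≤ Real.exp (A * (1 + ‖z‖))) ∧
      ∃ B : ℝ, ∀ z, B ≤ ‖z‖ → 1 ≤ ‖P z‖ := by
  classical
  induction S using Finset.induction with
  | empty =>
    intro F hF h
    exact ⟨fun _ => 1, F, hF, by simpa using h, by simp, ⟨0, le_rfl, by simp⟩, 0, by simp⟩
  | insert a S ha ih =>
    intro F hF h
    have hne : analyticOrderAt F a ≠ ⊤ := by
      rw [Ne, analyticOrderAt_eq_top]
      intro he
      refine infinite_of_mem_nhds a (s := (insert a S : Finset ℂ)) ?_ (Finset.finite_toSet _)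
      filter_upwards [he] with z hz
      exact (h z).1 hz
    obtain ⟨n, hn⟩ := ENat.ne_top_iff_exists.1 hne
    obtain ⟨g, hg, hga, hgF⟩ := (hF.analyticAt a).analyticOrderAt_eq_natCast.1 hn.symm
    set G : ℂ → ℂ := Function.update (fun z => F z / (z - a) ^ n) a (g a) with hG
    have hGne {z : ℂ} (hz : z ≠ a) : G z = F z / (z - a) ^ n := by simp [hG, hz]
    have hFG (z : ℂ) : F z = (z - a) ^ n * G z := by
      rcases eq_or_ne z a with rfl | hz
      · have := hgF.self_of_nhds
        simpa [hG] using this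
      · rw [hGne hz, mul_div_cancel₀ _ (pow_ne_zero _ (sub_ne_zero.2 hz))]
    have hGd : Differentiable ℂ G := by
      intro z
      rcases eq_or_ne z a with rfl | hz
      · refine hg.differentiableAt.congr_of_eventuallyEq ?_
        filter_upwards [hgF] with w hw
        rcases eq_or_ne w z with rfl | hwz
        · simp [hG]
        · rw [hGne hwz, hw, smul_eq_mul,
            mul_div_cancel_left₀ _ (pow_ne_zero _ (sub_ne_zero.2 hwz))]
      · have hd : DifferentiableAt ℂ (fun w => F w / (w - a) ^ n) z :=
          (hF z).div (by fun_prop) (pow_ne_zero _ (sub_ne_zero.2 hz))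
        refine hd.congr_of_eventuallyEq ?_
        filter_upwards [isOpen_ne.mem_nhds hz] with w hw
        exact hGne hw
    have hGz (z : ℂ) : G z = 0 ↔ z ∈ S := by
      rcases eq_or_ne z a with rfl | hz
      · simp [hG, hga, ha]
      · rw [hGne hz, div_eq_zero_iff, h z]
        simp [hz, sub_eq_zero]
    obtain ⟨P, H, hH, hH0, hPH, ⟨A, hA, hPA⟩, B, hB⟩ := ih G hGd hGz
    refine ⟨fun z => (z - a) ^ n * P z, H, hH, hH0, fun z => by rw [hFG, hPH]; ring,
      ⟨n * (1 + ‖a‖) + A, by positivity, fun z => ?_⟩, max B (1 + ‖a‖), fun z hz => ?_⟩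
    · have h1 : ‖z - a‖ ≤ Real.exp ((1 + ‖a‖) * (1 + ‖z‖)) := by
        have h2 := Real.add_one_le_exp ((1 + ‖a‖) * (1 + ‖z‖))
        have h3 := norm_sub_le z a
        nlinarith [norm_nonneg a, norm_nonneg z, mul_nonneg (norm_nonneg a) (norm_nonneg z)]
      calc ‖(z - a) ^ n * P z‖ = ‖z - a‖ ^ n * ‖P z‖ := by rw [norm_mul, norm_pow]
        _ ≤ Real.exp ((1 + ‖a‖) * (1 + ‖z‖)) ^ n * Real.exp (A * (1 + ‖z‖)) := by
          gcongr; exact hPA z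
        _ = _ := by rw [← Real.exp_nat_mul, ← Real.exp_add]; ring_nf
    · have h1 : 1 ≤ ‖z - a‖ := by
        have := norm_sub_norm_le z a
        linarith [le_max_right B (1 + ‖a‖)]
      rw [norm_mul, norm_pow]
      exact one_le_mul_of_one_le_of_one_le (one_le_pow₀ h1) (hB z ((le_max_left _ _).trans hz))

lemma exists_entire_log {G : ℂ → ℂ} (hG : Differentiable ℂ G) (h0 : ∀ z, G z ≠ 0) :
    ∃ g : ℂ → ℂ, Differentiable ℂ g ∧ ∀ z, exp (g z) = G z := by
  have hsc : IsSimplyConnected (univ : Set ℂ) := by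
    have : ContractibleSpace (univ : Set ℂ) := convex_univ.contractibleSpace univ_nonempty
    exact (inferInstance : SimplyConnectedSpace (univ : Set ℂ))
  obtain ⟨g, hgc, hg⟩ := exists_continuousOn_eqOn_exp_comp hsc isOpen_univ
    hG.continuous.continuousOn (by simpa using h0)
  have hg' (z : ℂ) : exp (g z) = G z := hg (mem_univ z)
  have hgc' : Continuous g := continuousOn_univ.1 hgc
  refine ⟨g, fun a => ?_, hg'⟩
  -- Near `a`, continuity keeps the imaginary part of `g z - g a` within `(-π, π)`, so the
  -- continuous logarithm agrees with this branch.
  have hd : DifferentiableAt ℂ (fun z => log (G z / G a) + g a) a := by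
    refine DifferentiableAt.add_const _ (DifferentiableAt.clog ((hG a).div_const _) ?_)
    rw [div_self (h0 a)]; simp
  refine hd.congr_of_eventuallyEq ?_
  have hc : Tendsto (fun z => (g z - g a).im) (𝓝 a) (𝓝 0) := by
    have : Continuous fun z => (g z - g a).im := by fun_prop
    simpa using this.tendsto a
  filter_upwards [hc.eventually_lt_const Real.pi_pos,
    hc.eventually_const_lt (neg_lt_zero.2 Real.pi_pos)] with z h1 h2
  rw [← hg' z, ← hg' a, ← exp_sub, log_exp h2 h1.le]
  ring

/-- Borel–Carathéodory turns the bound on the real part into `‖g‖ = O(R^(3/2))`, and Cauchy's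
estimate on radius `R / 4` then gives `g'' = O(R^(-1/2))`, hence `g'' = 0`. -/
lemma exists_affine_of_re_le {g : ℂ → ℂ} (hg : Differentiable ℂ g) {C R₀ : ℝ} (hC : 0 < C)
    (hb : ∀ R, R₀ ≤ R → ∀ z, ‖z‖ ≤ R → (g z).re ≤ C * ((1 + R) * √(1 + R))) :
    ∃ a d : ℂ, ∀ z, g z = a + d * z := by
  have hdd (w : ℂ) : iteratedDeriv 2 g w = 0 := by
    rw [← norm_le_zero_iff]
    have hlim : Tendsto (fun R : ℝ => 32 * (8 * C + 3 * ‖g 0‖) * (√R)⁻¹) atTop (𝓝 0) := by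
      have := (tendsto_inv_atTop_zero.comp Real.tendsto_sqrt_atTop).const_mul
        (32 * (8 * C + 3 * ‖g 0‖))
      simpa using this
    refine ge_of_tendsto hlim ?_
    filter_upwards [eventually_ge_atTop (max (max R₀ 1) (4 * ‖w‖))] with R hR
    have hR0 : R₀ ≤ R := (le_max_left _ _).trans ((le_max_left _ _).trans hR)
    have hR1 : 1 ≤ R := (le_max_right _ _).trans ((le_max_left _ _).trans hR)
    have hRw : 4 * ‖w‖ ≤ R := (le_max_right _ _).trans hR
    have hRp : 0 < R := by linarith
    have hs : √(1 + R) ≤ 2 * √R := by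
      rw [Real.sqrt_le_left (by positivity), mul_pow, Real.sq_sqrt (by linarith)]; linarith
    have hs1 : 1 ≤ √R := Real.one_le_sqrt.2 hR1
    have hss : √R * √R = R := Real.mul_self_sqrt hRp.le
    set M := C * (4 * R * √R) with hM
    have hMb (z : ℂ) (hz : z ∈ ball (0 : ℂ) R) : (g z).re ≤ M := by
      refine (hb R hR0 z (by simpa using (mem_ball.1 hz).le)).trans ?_
      rw [hM]
      calc C * ((1 + R) * √(1 + R)) ≤ C * ((2 * R) * (2 * √R)) := by gcongr; linarith
        _ = _ := by ring
    have hbound (z : ℂ) (hz : z ∈ sphere w (R / 4)) : ‖g z‖ ≤ (8 * C + 3 * ‖g 0‖) * (R * √R) := by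
      have hz' : ‖z‖ ≤ R / 2 := by
        have h1 : ‖z - w‖ = R / 4 := by simpa [dist_eq_norm] using hz
        have h2 := norm_le_norm_sub_add z w
        linarith
      have h3 := borelCaratheodory (M := M) (by positivity) hg.differentiableOn hMb hRp
        (z := z) (by simp; linarith)
      have hden : 0 < R - ‖z‖ := by linarith
      have h4 : 2 * M * ‖z‖ / (R - ‖z‖) ≤ 2 * M := by
        rw [div_le_iff₀ hden]
        have : 0 ≤ M := by positivity
        gcongr; linarith
      have h5 : ‖g 0‖ * (R + ‖z‖) / (R - ‖z‖) ≤ 3 * ‖g 0‖ := by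
        rw [div_le_iff₀ hden]
        nlinarith [norm_nonneg (g 0)]
      have h6 : ‖g 0‖ * 1 ≤ ‖g 0‖ * (R * √R) := by
        gcongr; exact one_le_mul_of_one_le_of_one_le hR1 hs1
      rw [hM] at h4
      rw [hM] at h3
      linarith
    have h := norm_iteratedDeriv_le_of_forall_mem_sphere_norm_le 2 (c := w) (R := R / 4)
      (by positivity) (hg.diffContOnCl) hbound
    refine h.trans_eq ?_
    have : √R ≠ 0 := by positivity
    have e : R = √R * √R := hss.symm
    rw [show ((2 : ℕ).factorial : ℝ) = 2 by norm_num]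
    generalize √R = q at *
    subst e
    field_simp
    ring
  have hd1 : Differentiable ℂ (deriv g) := fun z =>
    ((hg.analyticAt z).deriv).differentiableAt
  have hconst (z : ℂ) : deriv g z = deriv g 0 := by
    refine is_const_of_deriv_eq_zero hd1 (fun w => ?_) z 0
    have := hdd w
    rwa [iteratedDeriv_succ, iteratedDeriv_one] at this
  refine ⟨g 0, deriv g 0, fun z => ?_⟩
  have h := is_const_of_deriv_eq_zero (f := fun z => g z - deriv g 0 * z) (by fun_prop) (fun w => ?_) z 0
  · simp only [mul_zero, sub_zero] at h
    rw [← h]; ring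
  · rw [deriv_fun_sub (hg w) (by fun_prop), hconst w]
    simp

/-! ### Infinitude of the ordinates -/

lemma infinite_xi_zeros : {z : ℂ | xi z = 0}.Infinite := by
  intro hfin
  obtain ⟨P, G, hG, hG0, hPG, ⟨A, hA, hPA⟩, B, hB⟩ :=
    exists_factorization_of_finite_zeros hfin.toFinset xi differentiable_xi (by simp)
  obtain ⟨C, hC, hxi⟩ := exists_norm_xi_le
  obtain ⟨g, hg, hgG⟩ := exists_entire_log hG hG0
  have hre : ∀ R, max B 1 ≤ R → ∀ z, ‖z‖ ≤ R → (g z).re ≤ C * ((1 + R) * √(1 + R)) := by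
    intro R hR z hz
    have hR1 : 1 ≤ R := (le_max_right _ _).trans hR
    -- On the circle of radius `R` one has `‖P‖ ≥ 1`, so `G` inherits the bound for `xi`; the
    -- maximum principle carries it inside.
    have h1 : ‖G z‖ ≤ Real.exp (C * ((1 + R) * √(1 + R))) := by
      refine norm_le_of_forall_mem_frontier_norm_le (isBounded_ball (x := (0 : ℂ)) (r := R))
        hG.diffContOnCl (fun w hw => ?_) (by rw [closure_ball _ (by positivity)]; simpa using hz)
      rw [frontier_ball _ (by positivity)] at hw
      have hw' : ‖w‖ = R := by simpa using hw
      have h2 := hB w (by rw [hw']; exact (le_max_left _ _).trans hR)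
      have h3 := hxi w
      rw [hPG w, norm_mul, hw'] at h3
      exact (le_mul_of_one_le_left (norm_nonneg _) h2).trans h3
    rw [← hgG, norm_exp] at h1
    exact Real.exp_le_exp.1 h1
  obtain ⟨a, d, had⟩ := exists_affine_of_re_le hg hC hre
  set D := A + ‖a‖ + ‖d‖ with hD
  have hD0 : 0 ≤ D := by positivity
  have hup (z : ℂ) : ‖xi z‖ ≤ Real.exp (D * (1 + ‖z‖)) := by
    rw [hPG z, norm_mul, ← hgG, norm_exp, had]
    have h1 : (a + d * z).re ≤ (‖a‖ + ‖d‖) * (1 + ‖z‖) := by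
      refine (re_le_norm _).trans ((norm_add_le _ _).trans ?_)
      rw [norm_mul]
      nlinarith [norm_nonneg a, norm_nonneg d, norm_nonneg z,
        mul_nonneg (norm_nonneg a) (norm_nonneg z)]
    calc ‖P z‖ * Real.exp (a + d * z).re
        ≤ Real.exp (A * (1 + ‖z‖)) * Real.exp ((‖a‖ + ‖d‖) * (1 + ‖z‖)) := by
          gcongr; exact hPA z
      _ = _ := by rw [← Real.exp_add, hD]; ring_nf
  set Q := Real.pi * Real.exp (2 * D) with hQ
  -- Exponential type is confronted with factorial growth at `2 (n + 1)`; the right side tends to 0.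
  have hle (n : ℕ) : 1 ≤ Real.pi * Real.exp (3 * D) * (Q ^ n / n.factorial) := by
    have h1 := (xi_even_lower_bound n).trans (hup _)
    rw [norm_natCast] at h1
    have hfac : (0 : ℝ) < n.factorial := by positivity
    rw [inv_mul_le_iff₀ (by positivity)] at h1
    rw [← mul_div_assoc, le_div_iff₀ hfac, one_mul]
    refine h1.trans_eq ?_
    rw [hQ, mul_pow, ← Real.exp_nat_mul, pow_succ]
    have : Real.exp (D * (1 + ((2 * (n + 1) : ℕ) : ℝ))) =
        Real.exp (3 * D) * Real.exp (n * (2 * D)) := by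
      rw [← Real.exp_add]; push_cast; ring_nf
    rw [this]; ring
  have hlim := (FloorSemiring.tendsto_pow_div_factorial_atTop Q).const_mul
    (Real.pi * Real.exp (3 * D))
  rw [mul_zero] at hlim
  exact absurd (ge_of_tendsto' hlim hle) (by norm_num)

/-- The symmetry `s ↦ 1 - s` negates imaginary parts, so a bound for the positive ordinates confines
all zeros of `xi` to a disc, where the counting bound makes them finite in number. Real zeros need
not be excluded. -/
instance infinite_zetaOrdinates : Infinite zetaOrdinates := by
  rw [Set.infinite_coe_iff]
  intro hfin
  obtain ⟨B, hB⟩ := hfin.bddAbove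
  obtain ⟨K, hK, hcard⟩ := exists_card_xi_zeros_le
  set r := 1 + |B| with hr
  have hr1 : 1 ≤ r := by have := abs_nonneg B; linarith
  have hbound (z : ℂ) (hz : xi z = 0) : ‖z‖ ≤ r := by
    have him (w : ℂ) (hw : xi w = 0) : w.im ≤ |B| := by
      rcases le_or_gt w.im 0 with h | h
      · exact h.trans (abs_nonneg B)
      · obtain ⟨h1, h2, h3⟩ := (xi_eq_zero_iff w).1 hw
        exact (hB ⟨h, w, h1, h2, h3, rfl⟩).trans (le_abs_self B)
    have h1 := him z hz
    have h2 := him (1 - z) (by rw [xi_one_sub, hz])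
    obtain ⟨-, h3, h4⟩ := (xi_eq_zero_iff z).1 hz
    refine (norm_le_abs_re_add_abs_im z).trans (add_le_add ?_ ?_)
    · rw [abs_of_pos h3]; exact h4.le
    · rw [abs_le]
      simp at h2
      constructor <;> linarith
  obtain ⟨S, hS, hSc⟩ := infinite_xi_zeros.exists_subset_card_eq (⌊K * (r * √r)⌋₊ + 1)
  have h1 := hcard r hr1 S fun z hz => ⟨hS hz, hbound z (hS hz)⟩
  rw [hSc] at h1
  have := Nat.lt_floor_add_one (K * (r * √r))
  push_cast at h1
  linarith

end GoldbachM

namespace GoldbachM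

open Complex Set

/-! ### Characters -/

lemma psi_eq (z w : ℂ) : psi z w = exp (I * ((inner ℝ z w : ℝ) : ℂ)) := by
  rw [psi, Complex.inner, mul_comm w]

@[simp] lemma norm_psi (z w : ℂ) : ‖psi z w‖ = 1 := by
  rw [psi, mul_comm, norm_exp_ofReal_mul_I]

@[simp] lemma psi_zero_left (w : ℂ) : psi 0 w = 1 := by simp [psi]

lemma psi_sum {ι : Type*} (z : ℂ) (S : Finset ι) (w : ι → ℂ) :
    psi z (∑ i ∈ S, w i) = ∏ i ∈ S, psi z (w i) := by
  simp only [psi_eq, ← Complex.exp_sum, inner_sum, ofReal_sum, Finset.mul_sum]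

lemma continuous_psi : Continuous fun p : ℂ × ℂ => psi p.1 p.2 := by
  unfold psi; fun_prop

lemma norm_exp_I_mul_sub_le (x y : ℝ) : ‖exp (I * (x : ℂ)) - exp (I * (y : ℂ))‖ ≤ |x - y| := by
  have h : exp (I * (x : ℂ)) - exp (I * (y : ℂ)) =
      exp ((y : ℂ) * I) * (exp (I * ((x - y : ℝ) : ℂ)) - 1) := by
    rw [mul_sub, mul_one, ← Complex.exp_add]; push_cast; ring_nf
  rw [h, norm_mul, norm_exp_ofReal_mul_I, one_mul]
  exact Real.norm_exp_I_mul_ofReal_sub_one_le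

lemma norm_psi_sub_psi_right_le (z w w' : ℂ) : ‖psi z w - psi z w'‖ ≤ ‖z‖ * ‖w - w'‖ := by
  rw [psi_eq, psi_eq]
  refine (norm_exp_I_mul_sub_le _ _).trans ?_
  rw [← inner_sub_right]
  exact abs_real_inner_le_norm _ _

lemma norm_psi_sub_psi_left_le (z z' w : ℂ) : ‖psi z w - psi z' w‖ ≤ ‖z - z'‖ * ‖w‖ := by
  rw [psi_eq, psi_eq]
  refine (norm_exp_I_mul_sub_le _ _).trans ?_
  rw [← inner_sub_left]
  exact abs_real_inner_le_norm _ _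

/-! ### The Fourier transform of a circle -/

/-- The arguments of `z` and `w` only shift `θ`, and the integral over a full period ignores the
shift. Hence only `|b γ|` matters in `M̃`. -/
lemma integral_psi_circle (z w : ℂ) :
    ∫ θ in (0 : ℝ)..2 * Real.pi, psi z (w * exp (I * (θ : ℂ))) =
      ∫ θ in (0 : ℝ)..2 * Real.pi, exp (I * ((‖w‖ * ‖z‖ * Real.cos θ : ℝ) : ℂ)) := by
  set h : ℝ → ℂ := fun θ => exp (I * ((‖w‖ * ‖z‖ * Real.cos θ : ℝ) : ℂ)) with hh
  have key (θ : ℝ) : psi z (w * exp (I * (θ : ℂ))) = h (θ + (arg w - arg z)) := by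
    simp only [psi, hh]
    congr 3
    have hw : w = ‖w‖ * exp (arg w * I) := (norm_mul_exp_arg_mul_I w).symm
    have hz : (starRingEnd ℂ) z = ‖z‖ * exp (-(arg z * I)) := by
      conv_lhs => rw [← norm_mul_exp_arg_mul_I z]
      rw [map_mul, conj_ofReal, ← exp_conj]; simp
    have e : (starRingEnd ℂ) z * (w * exp (I * (θ : ℂ))) =
        ((‖w‖ * ‖z‖ : ℝ) : ℂ) * exp ((θ + (arg w - arg z) : ℝ) * I) := by
      rw [hz]
      conv_lhs => rw [hw]
      rw [show ((θ + (arg w - arg z) : ℝ) : ℂ) * I = -(arg z * I) + (arg w * I) + I * θ by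
        push_cast; ring, Complex.exp_add, Complex.exp_add]
      push_cast; ring
    rw [e, re_ofReal_mul, exp_ofReal_mul_I_re]
  simp_rw [key]
  rw [intervalIntegral.integral_comp_add_right, zero_add, add_comm (2 * Real.pi)]
  have hper : Function.Periodic h (2 * Real.pi) := fun θ => by
    simp only [hh, Real.cos_add_two_pi]
  rw [hper.intervalIntegral_add_eq _ 0, zero_add]

lemma circleFourier_eq {r : ℝ} (hr : 0 ≤ r) (z : ℂ) :
    circleFourier r z = (1 / (2 * Real.pi) : ℂ) *
      ∫ θ in (0 : ℝ)..2 * Real.pi, exp (I * ((r * ‖z‖ * Real.cos θ : ℝ) : ℂ)) := by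
  rw [circleFourier, integral_psi_circle, norm_real, Real.norm_of_nonneg hr]

lemma circleFourier_conj {r : ℝ} (hr : 0 ≤ r) (z : ℂ) :
    circleFourier r (starRingEnd ℂ z) = circleFourier r z := by
  rw [circleFourier_eq hr, circleFourier_eq hr, norm_conj]

lemma norm_one_div_two_pi : ‖(1 / (2 * Real.pi) : ℂ)‖ = 1 / (2 * Real.pi) := by
  rw [norm_div, norm_one, norm_mul, norm_ofNat, norm_real, Real.norm_of_nonneg Real.pi_pos.le]

lemma norm_circleFourier_le_one (r : ℝ) (z : ℂ) : ‖circleFourier r z‖ ≤ 1 := by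
  rw [circleFourier, norm_mul, norm_one_div_two_pi]
  have h := intervalIntegral.norm_integral_le_of_norm_le_const (a := 0) (b := 2 * Real.pi)
    (f := fun θ : ℝ => psi z (r * exp (I * (θ : ℂ)))) (C := 1) (fun θ _ => by simp)
  rw [sub_zero, abs_of_pos Real.two_pi_pos, one_mul] at h
  rw [one_div, inv_mul_le_iff₀ Real.two_pi_pos, mul_one]
  exact h

lemma norm_circleFourier_sub_one_le {r : ℝ} (hr : 0 ≤ r) (z : ℂ) :
    ‖circleFourier r z - 1‖ ≤ r * ‖z‖ := by
  have hc : Continuous fun θ : ℝ => psi z (r * exp (I * (θ : ℂ))) :=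
    continuous_psi.comp (by fun_prop : Continuous fun θ : ℝ => (z, (r : ℂ) * exp (I * (θ : ℂ))))
  have e : circleFourier r z - 1 = (1 / (2 * Real.pi) : ℂ) *
      ∫ θ in (0 : ℝ)..2 * Real.pi, (psi z (r * exp (I * (θ : ℂ))) - 1) := by
    rw [intervalIntegral.integral_sub (hc.intervalIntegrable _ _) (by simp), mul_sub, circleFourier]
    have : (Real.pi : ℂ) ≠ 0 := by exact_mod_cast Real.pi_ne_zero
    simp
    field_simp
  rw [e, norm_mul, norm_one_div_two_pi, one_div, inv_mul_le_iff₀ Real.two_pi_pos]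
  have h := intervalIntegral.norm_integral_le_of_norm_le_const (a := 0) (b := 2 * Real.pi)
    (f := fun θ : ℝ => psi z (r * exp (I * (θ : ℂ))) - 1) (C := r * ‖z‖) (fun θ _ => by
      have := norm_psi_sub_psi_right_le z (r * exp (I * (θ : ℂ))) 0
      rw [sub_zero, norm_mul, mul_comm I, norm_exp_ofReal_mul_I, norm_real,
        Real.norm_of_nonneg hr, mul_one] at this
      rw [mul_comm I, mul_comm r]
      simpa [psi] using this)
  rw [sub_zero, abs_of_pos Real.two_pi_pos] at h
  linarith

/-- First-derivative estimate for the oscillatory integral with phase `x cos θ`. -/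
lemma norm_integral_exp_cos_le_of_sin {a b x s : ℝ} (hab : a ≤ b) (hx : x ≠ 0) (hs : 0 < s)
    (hsin : ∀ θ ∈ Icc a b, s ≤ Real.sin θ) :
    ‖∫ θ in a..b, exp (I * ((x * Real.cos θ : ℝ) : ℂ))‖ ≤ (2 / s + (b - a) / s ^ 2) / |x| := by
  have hxC : (x : ℂ) ≠ 0 := by exact_mod_cast hx
  -- Integration by parts: dividing the exponential by the derivative of its phase gives a primitive
  -- up to the error `q`, which is also `O(1 / |x|)`.
  set F : ℝ → ℂ := fun θ => exp (I * ((x * Real.cos θ : ℝ) : ℂ)) * (I / x * ((Real.sin θ)⁻¹ : ℝ))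
    with hF
  set e : ℝ → ℂ := fun θ => exp (I * ((x * Real.cos θ : ℝ) : ℂ)) with he
  set q : ℝ → ℂ := fun θ => e θ * (I / x * ((-Real.cos θ / Real.sin θ ^ 2 : ℝ) : ℂ)) with hq
  have hne (θ : ℝ) (hθ : θ ∈ Icc a b) : Real.sin θ ≠ 0 := (hs.trans_le (hsin θ hθ)).ne'
  have hder (θ : ℝ) (hθ : θ ∈ Icc a b) : HasDerivAt F (e θ + q θ) θ := by
    have h1 : HasDerivAt e (e θ * (I * ((x * -Real.sin θ : ℝ) : ℂ))) θ :=
      ((((Real.hasDerivAt_cos θ).const_mul x).ofReal_comp).const_mul I).cexp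
    have h2 : HasDerivAt (fun θ : ℝ => I / x * (((Real.sin θ)⁻¹ : ℝ) : ℂ))
        (I / x * ((-Real.cos θ / Real.sin θ ^ 2 : ℝ) : ℂ)) θ :=
      (((Real.hasDerivAt_sin θ).fun_inv (hne θ hθ)).ofReal_comp).const_mul _
    refine (h1.mul h2).congr_deriv ?_
    have : (Real.sin θ : ℂ) ≠ 0 := by exact_mod_cast hne θ hθ
    simp only [hq]
    congr 1
    rw [ofReal_mul, ofReal_neg, ofReal_inv]
    field_simp
    simp
  have hec : Continuous e := by simp only [he]; fun_prop
  have hqc : ContinuousOn q (Icc a b) := by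
    simp only [hq]
    refine hec.continuousOn.mul (continuousOn_const.mul ?_)
    refine continuous_ofReal.comp_continuousOn ?_
    exact (by fun_prop : Continuous fun θ => -Real.cos θ).continuousOn.div (by fun_prop)
      fun θ hθ => pow_ne_zero _ (hne θ hθ)
  have hei : IntervalIntegrable e volume a b := hec.intervalIntegrable _ _
  have hqi : IntervalIntegrable q volume a b :=
    ContinuousOn.intervalIntegrable (by rwa [uIcc_of_le hab])
  have hftc : ∫ θ in a..b, (e θ + q θ) = F b - F a :=
    intervalIntegral.integral_eq_sub_of_hasDerivAt
      (fun θ hθ => hder θ (by rwa [uIcc_of_le hab] at hθ)) (hei.add hqi)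
  rw [intervalIntegral.integral_add hei hqi] at hftc
  have henorm (θ : ℝ) : ‖e θ‖ = 1 := by simp only [he]; rw [mul_comm, norm_exp_ofReal_mul_I]
  have hFb (θ : ℝ) (hθ : θ ∈ Icc a b) : ‖F θ‖ ≤ 1 / s / |x| := by
    have : ‖F θ‖ = (Real.sin θ)⁻¹ / |x| := by
      have h0 : 0 < Real.sin θ := hs.trans_le (hsin θ hθ)
      simp only [hF]
      rw [norm_mul, show ‖exp (I * ((x * Real.cos θ : ℝ) : ℂ))‖ = 1 from henorm θ, norm_mul,
        norm_div, norm_I, norm_real, norm_real, Real.norm_eq_abs, Real.norm_eq_abs,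
        abs_of_pos (inv_pos.2 h0)]
      ring
    rw [this, one_div]
    gcongr
    exact hsin θ hθ
  have hqb : ‖∫ θ in a..b, q θ‖ ≤ 1 / s ^ 2 / |x| * |b - a| := by
    refine intervalIntegral.norm_integral_le_of_norm_le_const fun θ hθ => ?_
    rw [uIoc_of_le hab] at hθ
    have hθ' : θ ∈ Icc a b := ⟨hθ.1.le, hθ.2⟩
    simp only [hq]
    rw [norm_mul, henorm, norm_mul, norm_div, norm_I, norm_real, norm_real, Real.norm_eq_abs,
      Real.norm_eq_abs, abs_div, abs_neg, abs_of_nonneg (sq_nonneg (Real.sin θ))]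
    have h1 := Real.abs_cos_le_one θ
    have h2 := hsin θ hθ'
    calc 1 * (1 / |x| * (|Real.cos θ| / Real.sin θ ^ 2)) ≤ 1 * (1 / |x| * (1 / s ^ 2)) := by gcongr
      _ = _ := by ring
  have hE : ∫ θ in a..b, e θ = F b - F a - ∫ θ in a..b, q θ := by rw [← hftc]; ring
  change ‖∫ θ in a..b, e θ‖ ≤ _
  rw [hE]
  have h1 := hFb a (left_mem_Icc.2 hab)
  have h2 := hFb b (right_mem_Icc.2 hab)
  calc _ ≤ ‖F b‖ + ‖F a‖ + ‖∫ θ in a..b, q θ‖ :=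
        (norm_sub_le _ _).trans (add_le_add_left (norm_sub_le _ _) _)
    _ ≤ 1 / s / |x| + 1 / s / |x| + 1 / s ^ 2 / |x| * |b - a| := by gcongr
    _ = _ := by rw [abs_of_nonneg (sub_nonneg.2 hab)]; ring

/-- The stationary points 0 and π are cut off at distance `δ`, costing `2 * δ`; between them the
sine is at least `δ / 2` and the derivative estimate costs at most `15 * δ`. This yields decay
`|x|^(-1/3)`, weaker than the true `|x|^(-1/2)` but sufficient. -/
lemma norm_integral_exp_cos_zero_pi_le {δ x : ℝ} (hδ : 0 < δ) (hδ1 : δ ≤ 1)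
    (hx : 1 ≤ δ ^ 3 * |x|) :
    ‖∫ θ in (0 : ℝ)..Real.pi, exp (I * ((x * Real.cos θ : ℝ) : ℂ))‖ ≤ 17 * δ := by
  have hx0 : x ≠ 0 := by rintro rfl; norm_num at hx
  have hxp : 0 < |x| := abs_pos.2 hx0
  have hpi := Real.pi_gt_three
  have hpi4 := Real.pi_lt_d2
  set e : ℝ → ℂ := fun θ => exp (I * ((x * Real.cos θ : ℝ) : ℂ)) with he
  have hec : Continuous e := by simp only [he]; fun_prop
  have hb (a b : ℝ) : ‖∫ θ in a..b, e θ‖ ≤ |b - a| := by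
    have := intervalIntegral.norm_integral_le_of_norm_le_const (a := a) (b := b) (f := e) (C := 1)
      fun θ _ => by simp only [he]; rw [mul_comm, norm_exp_ofReal_mul_I]
    simpa using this
  have hsplit : ∫ θ in (0 : ℝ)..Real.pi, e θ = (∫ θ in (0 : ℝ)..δ, e θ) +
      (∫ θ in δ..(Real.pi - δ), e θ) + ∫ θ in (Real.pi - δ)..Real.pi, e θ := by
    rw [intervalIntegral.integral_add_adjacent_intervals,
      intervalIntegral.integral_add_adjacent_intervals] <;> exact hec.intervalIntegrable _ _
  have hsin (θ : ℝ) (hθ : θ ∈ Icc δ (Real.pi - δ)) : δ / 2 ≤ Real.sin θ := by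
    have aux (t : ℝ) (h1 : δ ≤ t) (h2 : t ≤ Real.pi / 2) : δ / 2 ≤ Real.sin t := by
      refine le_trans ?_ (Real.mul_le_sin (by linarith) h2)
      calc δ / 2 = 1 / 2 * δ := by ring
        _ ≤ 2 / Real.pi * t := by
          gcongr ?_ * ?_
          rw [div_le_div_iff₀ (by norm_num) Real.pi_pos]; linarith
    rcases le_total θ (Real.pi / 2) with h | h
    · exact aux θ hθ.1 h
    · rw [← Real.sin_pi_sub]
      exact aux _ (by linarith [hθ.2]) (by linarith)
  have hmid := norm_integral_exp_cos_le_of_sin (a := δ) (b := Real.pi - δ) (x := x) (s := δ / 2)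
    (by linarith) hx0 (by linarith) hsin
  have h1 := hb 0 δ
  have h2 := hb (Real.pi - δ) Real.pi
  rw [sub_zero, abs_of_pos hδ] at h1
  rw [sub_sub_cancel, abs_of_pos hδ] at h2
  have h3 : (2 / (δ / 2) + (Real.pi - δ - δ) / (δ / 2) ^ 2) / |x| ≤ 15 * δ := by
    rw [div_le_iff₀ hxp]
    have e1 : 2 / (δ / 2) + (Real.pi - δ - δ) / (δ / 2) ^ 2 = (4 * Real.pi - 4 * δ) / δ ^ 2 := by
      field_simp; ring
    rw [e1, div_le_iff₀ (by positivity)]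
    nlinarith
  rw [hsplit]
  refine (norm_add₃_le).trans ?_
  linarith

lemma norm_circleFourier_le {r δ : ℝ} (hr : 0 ≤ r) {z : ℂ} (hδ : 0 < δ) (hδ1 : δ ≤ 1)
    (hx : 1 ≤ δ ^ 3 * (r * ‖z‖)) : ‖circleFourier r z‖ ≤ 6 * δ := by
  set x := r * ‖z‖ with hxdef
  have hx0 : 0 ≤ x := by positivity
  rw [circleFourier_eq hr, norm_mul, norm_one_div_two_pi, one_div,
    inv_mul_le_iff₀ Real.two_pi_pos, ← hxdef]
  have h1 := norm_integral_exp_cos_zero_pi_le (x := x) hδ hδ1 (by rwa [abs_of_nonneg hx0])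
  have h2 := norm_integral_exp_cos_zero_pi_le (x := -x) hδ hδ1 (by rwa [abs_neg, abs_of_nonneg hx0])
  set e : ℝ → ℂ := fun θ => exp (I * ((x * Real.cos θ : ℝ) : ℂ)) with he
  have hec : Continuous e := by simp only [he]; fun_prop
  have hsplit : ∫ θ in (0 : ℝ)..2 * Real.pi, e θ = (∫ θ in (0 : ℝ)..Real.pi, e θ) +
      ∫ θ in (0 : ℝ)..Real.pi, exp (I * ((-x * Real.cos θ : ℝ) : ℂ)) := by
    rw [← intervalIntegral.integral_add_adjacent_intervals (b := Real.pi)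
      (hec.intervalIntegrable _ _) (hec.intervalIntegrable _ _)]
    congr 1
    have := intervalIntegral.integral_comp_add_right (a := 0) (b := Real.pi) e Real.pi
    rw [zero_add, ← two_mul] at this
    rw [← this]
    refine intervalIntegral.integral_congr fun θ _ => ?_
    simp only [he, Real.cos_add_pi]
    congr 3; ring
  rw [hsplit]
  refine (norm_add_le _ _).trans ?_
  nlinarith [Real.pi_gt_three]

/-! ### The infinite product -/

lemma multipliable_circleFourier (z : ℂ) :
    Multipliable fun γ : zetaOrdinates => circleFourier (c γ) z := by
  have h : Summable fun γ : zetaOrdinates => ‖circleFourier (c γ) z - 1‖ :=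
    Summable.of_nonneg_of_le (fun _ => norm_nonneg _)
      (fun γ => norm_circleFourier_sub_one_le (c_pos γ).le z) (summable_c.mul_right ‖z‖)
  simpa using multipliable_one_add_of_summable h

lemma tendsto_prod_circleFourier (z : ℂ) :
    Tendsto (fun S : Finset zetaOrdinates => ∏ γ ∈ S, circleFourier (c γ) z) atTop
      (𝓝 (MTilde z)) := (multipliable_circleFourier z).hasProd

lemma MTilde_zero : MTilde 0 = 1 := by
  have h (γ : zetaOrdinates) : circleFourier (c γ) 0 = 1 := by
    have := norm_circleFourier_sub_one_le (c_pos γ).le 0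
    rw [norm_zero, mul_zero, norm_le_zero_iff, sub_eq_zero] at this
    exact this
  simp [MTilde, h]

lemma MTilde_conj (z : ℂ) : MTilde (starRingEnd ℂ z) = MTilde z :=
  tprod_congr fun γ => circleFourier_conj (c_pos γ).le z

lemma norm_MTilde_le_prod (S : Finset zetaOrdinates) (z : ℂ) :
    ‖MTilde z‖ ≤ ∏ γ ∈ S, ‖circleFourier (c γ) z‖ := by
  classical
  refine le_of_tendsto (tendsto_prod_circleFourier z).norm ?_
  filter_upwards [eventually_ge_atTop S] with T hT
  rw [norm_prod, ← Finset.prod_sdiff hT]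
  refine mul_le_of_le_one_left (Finset.prod_nonneg fun _ _ => norm_nonneg _) ?_
  exact Finset.prod_le_one (fun _ _ => norm_nonneg _) fun _ _ => norm_circleFourier_le_one _ _

lemma norm_MTilde_le_one (z : ℂ) : ‖MTilde z‖ ≤ 1 := by
  simpa using norm_MTilde_le_prod ∅ z

lemma exists_norm_MTilde_le : ∃ C : ℝ, ∀ z : ℂ, ‖MTilde z‖ ≤ C * (1 + ‖z‖) ^ (-3 : ℝ) := by
  -- Nine factors of decay 1/3 give exponent 3, more than the dimension 2. Below, `κ` is the
  -- smallest of the nine radii, so one `δ` serves all of them.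
  obtain ⟨S, hS⟩ := Infinite.exists_subset_card_eq zetaOrdinates 9
  have hSne : S.Nonempty := Finset.card_pos.1 (by omega)
  obtain ⟨γ₀, -, hmin⟩ := S.exists_min_image (fun γ => c γ) hSne
  set κ := c γ₀ with hκ
  have hκ0 : 0 < κ := c_pos _
  refine ⟨6 ^ 9 * ((1 + κ) / κ) ^ 3, fun z => ?_⟩
  have hz0 := norm_nonneg z
  rw [show (-3 : ℝ) = -((3 : ℕ) : ℝ) by norm_num, Real.rpow_neg (by positivity), Real.rpow_natCast,
    ← div_eq_mul_inv, le_div_iff₀ (by positivity)]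
  rcases le_total (κ * ‖z‖) 1 with h | h
  · have h1 : 1 + ‖z‖ ≤ (1 + κ) / κ := by rw [le_div_iff₀ hκ0]; linarith
    calc ‖MTilde z‖ * (1 + ‖z‖) ^ 3 ≤ 1 * ((1 + κ) / κ) ^ 3 := by
          gcongr; exact norm_MTilde_le_one z
      _ ≤ _ := by gcongr; norm_num
  · set δ := (κ * ‖z‖) ^ (-(1 / 3) : ℝ) with hδ
    have hx0 : 0 < κ * ‖z‖ := by linarith
    have hδ0 : 0 < δ := Real.rpow_pos_of_pos hx0 _
    have hδ1 : δ ≤ 1 := Real.rpow_le_one_of_one_le_of_nonpos h (by norm_num)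
    have hδ3 : δ ^ 3 * (κ * ‖z‖) = 1 := by
      rw [hδ, ← Real.rpow_natCast, ← Real.rpow_mul hx0.le]
      norm_num
      rw [Real.rpow_neg_one, inv_mul_cancel₀ hx0.ne']
    have h1 : ‖MTilde z‖ ≤ (6 * δ) ^ 9 := by
      refine (norm_MTilde_le_prod S z).trans ?_
      rw [← hS, ← Finset.prod_const]
      refine Finset.prod_le_prod (fun _ _ => norm_nonneg _) fun γ hγ => ?_
      refine norm_circleFourier_le (c_pos _).le hδ0 hδ1 (hδ3.symm.le.trans ?_)
      gcongr
      exact hmin γ hγ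
    have h2 : 1 + ‖z‖ ≤ (1 + κ) / κ * (κ * ‖z‖) := by field_simp; linarith
    calc ‖MTilde z‖ * (1 + ‖z‖) ^ 3 ≤ (6 * δ) ^ 9 * ((1 + κ) / κ * (κ * ‖z‖)) ^ 3 := by gcongr
      _ = 6 ^ 9 * ((1 + κ) / κ) ^ 3 * (δ ^ 3 * (κ * ‖z‖)) ^ 3 := by ring
      _ = _ := by rw [hδ3]; ring

lemma integrable_MTilde_of_continuous (hc : Continuous MTilde) : Integrable MTilde volume := by
  obtain ⟨C, hC⟩ := exists_norm_MTilde_le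
  have h : Integrable (fun z : ℂ => C * (1 + ‖z‖) ^ (-3 : ℝ)) volume :=
    (integrable_one_add_norm (by simp; norm_num)).const_mul C
  exact h.mono' hc.aestronglyMeasurable (Eventually.of_forall hC)

end GoldbachM

namespace GoldbachM

open Complex Set

/-! ### Time means -/

/-- The mean value of `g` over `[0, X]`. -/
noncomputable def timeMean (g : ℝ → ℂ) (X : ℝ) : ℂ := (1 / X : ℂ) * ∫ α in (0 : ℝ)..X, g α

lemma norm_timeMean_le {g : ℝ → ℂ} {C X : ℝ} (hX : 0 < X) (hg : ∀ α, ‖g α‖ ≤ C) :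
    ‖timeMean g X‖ ≤ C := by
  have h := intervalIntegral.norm_integral_le_of_norm_le_const (a := 0) (b := X) (f := g)
    fun α _ => hg α
  rw [sub_zero, abs_of_pos hX] at h
  rw [timeMean, norm_mul, norm_div, norm_one, norm_real, Real.norm_of_nonneg hX.le, one_div,
    inv_mul_le_iff₀ hX]
  linarith

lemma timeMean_sub {g h : ℝ → ℂ} (hg : Continuous g) (hh : Continuous h) (X : ℝ) :
    timeMean (fun α => g α - h α) X = timeMean g X - timeMean h X := by
  simp only [timeMean]
  rw [intervalIntegral.integral_sub (hg.intervalIntegrable _ _) (hh.intervalIntegrable _ _), mul_sub]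

lemma timeMean_add {g h : ℝ → ℂ} (hg : Continuous g) (hh : Continuous h) (X : ℝ) :
    timeMean (fun α => g α + h α) X = timeMean g X + timeMean h X := by
  simp only [timeMean]
  rw [intervalIntegral.integral_add (hg.intervalIntegrable _ _) (hh.intervalIntegrable _ _), mul_add]

lemma timeMean_const_mul (a : ℂ) (g : ℝ → ℂ) (X : ℝ) :
    timeMean (fun α => a * g α) X = a * timeMean g X := by
  simp only [timeMean, intervalIntegral.integral_const_mul]; ring

/-- A uniform limit of functions with mean values has a mean value. -/
lemma tendsto_timeMean_of_approx {g : ℝ → ℂ} (hg : Continuous g) {l : ℂ}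
    (H : ∀ ε > 0, ∃ (h : ℝ → ℂ) (m : ℂ), Continuous h ∧ (∀ α, ‖g α - h α‖ ≤ ε) ∧ ‖m - l‖ ≤ ε ∧
      Tendsto (timeMean h) atTop (𝓝 m)) : Tendsto (timeMean g) atTop (𝓝 l) := by
  rw [Metric.tendsto_atTop']
  intro ε hε
  obtain ⟨h, m, hh, hgh, hml, hlim⟩ := H (ε / 4) (by positivity)
  obtain ⟨N, hN⟩ := Metric.tendsto_atTop'.1 hlim (ε / 4) (by positivity)
  refine ⟨max N 0, fun X hX => ?_⟩
  have h1 := hN X ((le_max_left _ _).trans_lt hX)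
  have h2 := norm_timeMean_le ((le_max_right _ _).trans_lt hX) hgh
  rw [timeMean_sub hg hh] at h2
  rw [dist_eq_norm] at h1 ⊢
  calc ‖timeMean g X - l‖
      = ‖(timeMean g X - timeMean h X) + (timeMean h X - m) + (m - l)‖ := by ring_nf
    _ ≤ ‖timeMean g X - timeMean h X‖ + ‖timeMean h X - m‖ + ‖m - l‖ := norm_add₃_le
    _ < ε := by linarith

lemma tendsto_timeMean_exp {ω : ℝ} (hω : ω ≠ 0) :
    Tendsto (timeMean fun α => exp (I * ω * α)) atTop (𝓝 0) := by
  have hne : I * (ω : ℂ) ≠ 0 := mul_ne_zero I_ne_zero (by exact_mod_cast hω)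
  rw [tendsto_zero_iff_norm_tendsto_zero]
  refine squeeze_zero' (g := fun X : ℝ => X⁻¹ * (2 / |ω|)) (Eventually.of_forall fun _ => norm_nonneg _)
    ?_ (by simpa using tendsto_inv_atTop_zero.mul_const (2 / |ω|))
  filter_upwards [eventually_gt_atTop 0] with X hX
  rw [timeMean, integral_exp_mul_complex hne, norm_mul, norm_div, norm_one, norm_real,
    Real.norm_of_nonneg hX.le, one_div, norm_div, norm_mul, norm_I, one_mul, norm_real,
    Real.norm_eq_abs]
  gcongr
  refine (norm_sub_le _ _).trans ?_
  have h (t : ℝ) : ‖exp (I * ω * t)‖ = 1 := by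
    rw [show I * ω * t = ((ω * t : ℝ) : ℂ) * I by push_cast; ring, norm_exp_ofReal_mul_I]
  rw [h, h]; norm_num

/-! ### Equidistribution of linear flows on tori -/

instance isProbabilityMeasure_unitAddCircle :
    IsProbabilityMeasure (volume : Measure UnitAddCircle) := ⟨UnitAddCircle.measure_univ⟩

instance isProbabilityMeasure_unitAddTorus {d : Type*} [Fintype d] :
    IsProbabilityMeasure (volume : Measure (UnitAddTorus d)) :=
  inferInstanceAs (IsProbabilityMeasure (Measure.pi fun _ : d => (volume : Measure UnitAddCircle)))

lemma integral_fourier_unitAddCircle {n : ℤ} (hn : n ≠ 0) :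
    ∫ x : UnitAddCircle, fourier n x = 0 := by
  rw [← UnitAddCircle.intervalIntegral_preimage 0, zero_add]
  have h1 : ∀ x : ℝ, fourier n (x : UnitAddCircle) = exp (2 * Real.pi * I * n * x) := fun x => by
    rw [fourier_coe_apply]; simp
  have hne : (2 * Real.pi * I * n : ℂ) ≠ 0 := by
    have := Real.pi_ne_zero
    simp [hn, this]
  simp_rw [h1]
  rw [integral_exp_mul_complex hne]
  have : exp (2 * Real.pi * I * n * (1 : ℝ)) = 1 := by
    rw [Complex.exp_eq_one_iff]; exact ⟨n, by push_cast; ring⟩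
  rw [this]; simp

lemma integral_mFourier {d : Type*} [Fintype d] {n : d → ℤ} (hn : n ≠ 0) :
    ∫ x : UnitAddTorus d, UnitAddTorus.mFourier n x = 0 := by
  obtain ⟨i, hi⟩ := Function.ne_iff.1 hn
  have h := integral_fintype_prod_volume_eq_prod (𝕜 := ℂ) (E := fun _ : d => UnitAddCircle)
    fun i x => fourier (n i) x
  refine h.trans (Finset.prod_eq_zero (Finset.mem_univ i) ?_)
  exact integral_fourier_unitAddCircle hi

lemma continuous_linearFlow {d : Type*} (ω : d → ℝ) :
    Continuous fun (α : ℝ) (i : d) => ((α * ω i : ℝ) : UnitAddCircle) :=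
  continuous_pi fun i => (AddCircle.continuous_mk' 1).comp (by fun_prop)

/-- **Kronecker–Weyl**: a linear flow with rationally independent frequencies equidistributes. -/
theorem tendsto_timeMean_linearFlow {d : Type*} [Fintype d] {ω : d → ℝ}
    (hω : ∀ n : d → ℤ, ∑ i, n i * ω i = 0 → n = 0) (G : C(UnitAddTorus d, ℂ)) :
    Tendsto (timeMean fun α => G fun i => ((α * ω i : ℝ) : UnitAddCircle)) atTop
      (𝓝 (∫ x, G x)) := by
  have hcont (G : C(UnitAddTorus d, ℂ)) :
      Continuous fun α : ℝ => G fun i => ((α * ω i : ℝ) : UnitAddCircle) :=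
    G.continuous.comp (continuous_linearFlow ω)
  have hint (G : C(UnitAddTorus d, ℂ)) : Integrable G volume :=
    G.continuous.integrable_of_hasCompactSupport (HasCompactSupport.of_compactSpace _)
  -- Along the flow a nontrivial character is a pure oscillation of nonzero frequency, so both its
  -- time mean in the limit and its integral vanish. Trigonometric polynomials follow by linearity,
  -- all continuous functions by uniform density.
  have hspan : ∀ G ∈ Submodule.span ℂ (range (UnitAddTorus.mFourier (d := d))),
      Tendsto (timeMean fun α => G fun i => ((α * ω i : ℝ) : UnitAddCircle)) atTop
        (𝓝 (∫ x, G x)) := by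
    intro G hG
    induction hG using Submodule.span_induction with
    | mem G hG =>
      obtain ⟨n, rfl⟩ := hG
      have hval (α : ℝ) : UnitAddTorus.mFourier n (fun i => ((α * ω i : ℝ) : UnitAddCircle)) =
          exp (I * ((2 * Real.pi * ∑ i, n i * ω i : ℝ) : ℂ) * α) := by
        simp only [UnitAddTorus.mFourier, ContinuousMap.coe_mk, fourier_coe_apply,
          ← Complex.exp_sum]
        congr 1
        push_cast
        rw [Finset.mul_sum, Finset.mul_sum, Finset.sum_mul]
        refine Finset.sum_congr rfl fun i _ => ?_
        simp; ring
      simp_rw [hval]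
      rcases eq_or_ne n 0 with rfl | hn
      · have h1 : ∫ x : UnitAddTorus d, UnitAddTorus.mFourier (0 : d → ℤ) x = 1 := by
          simp [UnitAddTorus.mFourier_zero]
        rw [h1]
        refine tendsto_const_nhds.congr' ?_
        filter_upwards [eventually_gt_atTop 0] with X hX
        have : (X : ℂ) ≠ 0 := by exact_mod_cast hX.ne'
        simp [timeMean, this]
      · rw [integral_mFourier hn]
        refine tendsto_timeMean_exp (mul_ne_zero Real.two_pi_pos.ne' fun h => hn (hω n h))
    | zero =>
      have h0 : timeMean (fun _ => 0) = fun _ => 0 := by ext; simp [timeMean]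
      simp [h0]
    | add G H _ _ ihG ihH =>
      have := ihG.add ihH
      simp only [ContinuousMap.add_apply]
      rw [integral_add (hint G) (hint H)]
      refine this.congr fun X => ?_
      rw [timeMean_add (hcont G) (hcont H)]
    | smul a G _ ih =>
      simp only [ContinuousMap.smul_apply, smul_eq_mul]
      rw [integral_const_mul]
      refine (ih.const_mul a).congr fun X => ?_
      rw [timeMean_const_mul]
  refine tendsto_timeMean_of_approx (hcont G) fun ε hε => ?_
  have hG : G ∈ closure (Submodule.span ℂ (range (UnitAddTorus.mFourier (d := d))) : Set _) := by
    rw [← Submodule.topologicalClosure_coe, UnitAddTorus.span_mFourier_closure_eq_top]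
    trivial
  obtain ⟨H, hH, hGH⟩ := Metric.mem_closure_iff.1 hG ε hε
  have hpt (x : UnitAddTorus d) : ‖G x - H x‖ ≤ ε := by
    rw [← dist_eq_norm]
    exact (ContinuousMap.dist_apply_le_dist x).trans hGH.le
  refine ⟨_, _, hcont H, fun α => hpt _, ?_, hspan H hH⟩
  rw [norm_sub_rev, ← integral_sub (hint G) (hint H)]
  refine (norm_integral_le_of_norm_le_const (Eventually.of_forall hpt)).trans ?_
  simp

/-! ### The series `f` -/

lemma norm_fTerm (α γ : ℝ) : ‖fTerm α γ‖ = c γ := by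
  rw [fTerm, norm_div, show I * (α : ℂ) * γ = ((α * γ : ℝ) : ℂ) * I by push_cast; ring,
    norm_exp_ofReal_mul_I, c]

/-- The radius `∑ c(γ)` of a disc containing all values of `f`. -/
noncomputable def radius : ℝ := ∑' γ : zetaOrdinates, c γ

lemma radius_nonneg : 0 ≤ radius := tsum_nonneg fun _ => (c_pos _).le

lemma norm_f_le (α : ℝ) : ‖f α‖ ≤ radius :=
  tsum_of_norm_bounded summable_c.hasSum fun γ => (norm_fTerm α γ).le

lemma continuous_fTerm (γ : ℝ) : Continuous fun α => fTerm α γ := by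
  unfold fTerm; fun_prop

lemma continuous_f : Continuous f :=
  continuous_tsum (fun γ => continuous_fTerm γ) summable_c fun γ α => (norm_fTerm α γ).le

lemma exists_finset_norm_f_sub_le {ε : ℝ} (hε : 0 < ε) (T : Finset zetaOrdinates) :
    ∃ S : Finset zetaOrdinates, T ⊆ S ∧ ∀ α, ‖f α - ∑ γ ∈ S, fTerm α γ‖ ≤ ε := by
  have h := tendstoUniformly_tsum summable_c fun (γ : zetaOrdinates) α => (norm_fTerm α γ).le
  obtain ⟨S, hS, hTS⟩ :=
    ((Metric.tendstoUniformly_iff.1 h ε hε).and (eventually_ge_atTop T)).exists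
  exact ⟨S, hTS, fun α => by rw [← dist_eq_norm]; exact (hS α).le⟩

lemma integral_unitAddCircle_psi (z w : ℂ) :
    ∫ x : UnitAddCircle, psi z (w * (AddCircle.toCircle x : ℂ)) = circleFourier ‖w‖ z := by
  rw [← UnitAddCircle.intervalIntegral_preimage 0, zero_add, circleFourier_eq (norm_nonneg w),
    ← integral_psi_circle]
  have h := intervalIntegral.integral_comp_mul_left (a := 0) (b := 1)
    (fun θ : ℝ => psi z (w * exp (I * (θ : ℂ)))) (c := 2 * Real.pi) Real.two_pi_pos.ne'
  rw [mul_zero, mul_one] at h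
  have e (x : ℝ) : psi z (w * (AddCircle.toCircle (x : UnitAddCircle) : ℂ)) =
      psi z (w * exp (I * ((2 * Real.pi * x : ℝ) : ℂ))) := by
    rw [AddCircle.toCircle_apply_mk, Circle.coe_exp, div_one, mul_comm I]
  simp_rw [e]
  rw [h, Complex.real_smul]
  push_cast
  rw [one_div]

/-- `ψ_z` turns the finite sum into a product of functions of separate torus coordinates, so the
equidistribution integral factors. The frequencies are `γ / 2π` because the circle has period 1. -/
lemma tendsto_timeMean_psi_sum
    (hLIC : LinearIndependent ℚ (fun γ : zetaOrdinates => (γ : ℝ))) (z : ℂ)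
    (S : Finset zetaOrdinates) :
    Tendsto (timeMean fun α => psi z (∑ γ ∈ S, fTerm α γ)) atTop
      (𝓝 (∏ γ ∈ S, circleFourier (c γ) z)) := by
  set ω : S → ℝ := fun γ => (γ : zetaOrdinates) / (2 * Real.pi) with hωdef
  have hω : ∀ n : S → ℤ, ∑ i, n i * ω i = 0 → n = 0 := by
    intro n hn
    have hn' : ∑ γ : S, (n γ : ℚ) • (((γ : zetaOrdinates) : ℝ)) = 0 := by
      have h1 : ∑ i, n i * ω i = (∑ γ : S, (n γ : ℚ) • (((γ : zetaOrdinates) : ℝ))) / (2 * Real.pi) := by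
        rw [Finset.sum_div]
        refine Finset.sum_congr rfl fun i _ => ?_
        rw [Rat.smul_def, hωdef]
        push_cast
        ring
      rw [h1, div_eq_zero_iff] at hn
      exact hn.resolve_right Real.two_pi_pos.ne'
    have hli := hLIC.comp (fun γ : S => (γ : zetaOrdinates)) Subtype.val_injective
    have := Fintype.linearIndependent_iff.1 hli (fun γ => (n γ : ℚ)) hn'
    ext γ
    exact_mod_cast this γ
  have hone (z w : ℂ) : Continuous fun x : UnitAddCircle => psi z (w * (AddCircle.toCircle x : ℂ)) := by
    have hc : Continuous fun x : UnitAddCircle => w * (AddCircle.toCircle x : ℂ) :=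
      continuous_const.mul (continuous_subtype_val.comp AddCircle.continuous_toCircle)
    exact continuous_psi.comp (continuous_const.prodMk hc)
  set G : C(UnitAddTorus S, ℂ) :=
    ⟨fun x => ∏ γ : S, psi z ((b (γ : zetaOrdinates))⁻¹ * (AddCircle.toCircle (x γ) : ℂ)),
      continuous_finsetProd _ fun γ _ => (hone z _).comp (continuous_apply γ)⟩ with hG
  have h := tendsto_timeMean_linearFlow hω G
  have hint : ∫ x, G x = ∏ γ ∈ S, circleFourier (c γ) z := by
    have h1 := integral_fintype_prod_volume_eq_prod (𝕜 := ℂ) (E := fun _ : S => UnitAddCircle)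
      fun γ x => psi z ((b (γ : zetaOrdinates))⁻¹ * (AddCircle.toCircle x : ℂ))
    refine h1.trans ?_
    simp_rw [integral_unitAddCircle_psi, norm_inv, ← one_div]
    exact Finset.prod_coe_sort S fun γ => circleFourier (c γ) z
  rw [hint] at h
  refine h.congr fun X => ?_
  congr 1
  funext α
  rw [psi_sum, ← Finset.prod_coe_sort]
  refine Finset.prod_congr rfl fun γ _ => ?_
  rw [AddCircle.toCircle_apply_mk, Circle.coe_exp, fTerm, mul_comm (b _)⁻¹, ← div_eq_mul_inv]
  congr 3
  have : (Real.pi : ℂ) ≠ 0 := by exact_mod_cast Real.pi_ne_zero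
  simp only [hωdef]
  push_cast
  field_simp

lemma continuous_psi_f (z : ℂ) : Continuous fun α => psi z (f α) :=
  continuous_psi.comp (continuous_const.prodMk continuous_f)

/-- The mean values of the characters along `f`. -/
theorem tendsto_timeMean_psi_f
    (hLIC : LinearIndependent ℚ (fun γ : zetaOrdinates => (γ : ℝ))) (z : ℂ) :
    Tendsto (timeMean fun α => psi z (f α)) atTop (𝓝 (MTilde z)) := by
  refine tendsto_timeMean_of_approx (continuous_psi_f z) fun ε hε => ?_
  obtain ⟨T, hT⟩ := eventually_atTop.1
    (Metric.tendsto_nhds.1 (tendsto_prod_circleFourier z) ε hε)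
  obtain ⟨S, hTS, hS⟩ := exists_finset_norm_f_sub_le (ε := ε / (1 + ‖z‖)) (by positivity) T
  refine ⟨_, _, ?_, fun α => ?_, ?_, tendsto_timeMean_psi_sum hLIC z S⟩
  · have hsum : Continuous fun α => ∑ γ ∈ S, fTerm α γ :=
      continuous_finsetSum _ fun γ _ => continuous_fTerm γ
    exact continuous_psi.comp (continuous_const.prodMk hsum)
  · refine (norm_psi_sub_psi_right_le _ _ _).trans ?_
    calc ‖z‖ * ‖f α - ∑ γ ∈ S, fTerm α γ‖ ≤ (1 + ‖z‖) * (ε / (1 + ‖z‖)) := by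
          gcongr
          · linarith
          · exact hS α
      _ = ε := by field_simp
  · rw [← dist_eq_norm]; exact (hT S hTS).le

/-- As a limit of means of `ψ_z(f(α))`, with `f` bounded by `radius`, `M̃` is Lipschitz with that
constant. -/
lemma continuous_MTilde (hLIC : LinearIndependent ℚ (fun γ : zetaOrdinates => (γ : ℝ))) :
    Continuous MTilde := by
  refine (LipschitzWith.of_dist_le_mul (K := ⟨radius, radius_nonneg⟩) fun z z' => ?_).continuous
  rw [dist_eq_norm, dist_eq_norm]
  refine le_of_tendsto
    ((tendsto_timeMean_psi_f hLIC z).sub (tendsto_timeMean_psi_f hLIC z')).norm ?_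
  filter_upwards [eventually_gt_atTop 0] with X hX
  rw [← timeMean_sub (continuous_psi_f z) (continuous_psi_f z')]
  refine norm_timeMean_le hX fun α => (norm_psi_sub_psi_left_le _ _ _).trans ?_
  rw [mul_comm]
  exact mul_le_mul_of_nonneg_right (norm_f_le α) (norm_nonneg _)

end GoldbachM

namespace GoldbachM

open Complex Set FourierTransform SchwartzMap

/-! ### The density -/

/-- `M̃` in the variable dual to the kernel `e^{-2πi⟨v, w⟩}`. -/
noncomputable def scaledMTilde (v : ℂ) : ℂ := MTilde ((2 * Real.pi) • v)

/-- The density of the limit distribution of `f` with respect to Lebesgue measure. -/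
noncomputable def density : ℂ → ℂ := 𝓕 scaledMTilde

lemma continuous_scaledMTilde (hLIC : LinearIndependent ℚ (fun γ : zetaOrdinates => (γ : ℝ))) :
    Continuous scaledMTilde :=
  (continuous_MTilde hLIC).comp (continuous_const_smul _)

lemma integrable_scaledMTilde (hLIC : LinearIndependent ℚ (fun γ : zetaOrdinates => (γ : ℝ))) :
    Integrable scaledMTilde :=
  (integrable_MTilde_of_continuous (continuous_MTilde hLIC)).comp_smul Real.two_pi_pos.ne'

lemma continuous_density (hLIC : LinearIndependent ℚ (fun γ : zetaOrdinates => (γ : ℝ))) :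
    Continuous density :=
  VectorFourier.fourierIntegral_continuous (L := innerₗ ℂ) Real.continuous_fourierChar
    continuous_inner (integrable_scaledMTilde hLIC)

lemma integral_dw {E : Type*} [NormedAddCommGroup E] [NormedSpace ℝ E] (g : ℂ → E) :
    ∫ z, g z ∂dw = (1 / (2 * Real.pi)) • ∫ z, g z := by
  rw [dw, integral_smul_measure, ENNReal.toReal_ofReal (by positivity)]

lemma integrable_dw {E : Type*} [NormedAddCommGroup E] {g : ℂ → E} (hg : Integrable g volume) :
    Integrable g dw := hg.smul_measure ENNReal.ofReal_ne_top

/-- Substituting `z = 2πv` in the plane gives `(2π)²`, of which `|dz|` absorbs one factor. -/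
lemma MInt_eq (w : ℂ) : MInt w = (2 * Real.pi) • density w := by
  have h := Measure.integral_comp_smul (volume : Measure ℂ) (fun z => MTilde z * psi (-w) z)
    (2 * Real.pi)
  have e : density w = ∫ v : ℂ, MTilde ((2 * Real.pi) • v) * psi (-w) ((2 * Real.pi) • v) := by
    rw [density, Real.fourier_eq']
    congr 1
    funext v
    rw [smul_eq_mul, mul_comm, scaledMTilde, psi_eq, mul_comm I, inner_neg_left,
      real_inner_smul_right, real_inner_comm]
    congr 4
    ring
  rw [MInt, integral_dw, e, h, Complex.finrank_real_complex, smul_smul, abs_of_pos (by positivity)]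
  congr 1
  field_simp

/-! ### Time means of Schwartz functions -/

lemma schwartz_eq_integral (φ : 𝓢(ℂ, ℂ)) (w : ℂ) :
    φ w = ∫ v : ℂ, psi ((2 * Real.pi) • v) w * 𝓕 φ v := by
  have h : 𝓕⁻ (𝓕 φ) w = φ w := by rw [FourierTransform.fourierInv_fourier_eq]
  rw [← h, fourierInv_coe, Real.fourierInv_eq']
  congr 1
  funext v
  rw [smul_eq_mul, psi_eq, mul_comm I, real_inner_smul_left]

lemma continuous_psi_smul_f :
    Continuous fun p : ℝ × ℂ => psi ((2 * Real.pi) • p.2) (f p.1) := by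
  have h1 : Continuous fun p : ℝ × ℂ => (2 * Real.pi) • p.2 := by fun_prop
  have h2 : Continuous fun p : ℝ × ℂ => f p.1 := continuous_f.comp continuous_fst
  exact continuous_psi.comp (h1.prodMk h2)

lemma timeMean_schwartz (φ : 𝓢(ℂ, ℂ)) {X : ℝ} (hX : 0 < X) :
    timeMean (fun α => φ (f α)) X =
      ∫ v : ℂ, timeMean (fun α => psi ((2 * Real.pi) • v) (f α)) X * 𝓕 φ v := by
  have hint : Integrable (Function.uncurry fun (α : ℝ) (v : ℂ) =>
      psi ((2 * Real.pi) • v) (f α) * 𝓕 φ v)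
      ((volume.restrict (Ioc 0 X)).prod (volume : Measure ℂ)) := by
    refine Integrable.bdd_mul (c := 1) ((𝓕 φ).integrable.comp_snd _)
      continuous_psi_smul_f.aestronglyMeasurable (Eventually.of_forall fun p => by simp)
  have h := integral_integral_swap hint
  simp only [timeMean, intervalIntegral.integral_of_le hX.le]
  simp_rw [schwartz_eq_integral φ]
  rw [h, ← integral_const_mul]
  congr 1
  funext v
  rw [integral_mul_const, mul_assoc]

lemma continuous_timeMean_psi (X : ℝ) :
    Continuous fun v : ℂ => timeMean (fun α => psi ((2 * Real.pi) • v) (f α)) X := by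
  have hc : Continuous (Function.uncurry fun (v : ℂ) (α : ℝ) =>
      psi ((2 * Real.pi) • v) (f α)) := by
    have h1 : Continuous fun p : ℂ × ℝ => (2 * Real.pi) • p.1 := by fun_prop
    have h2 : Continuous fun p : ℂ × ℝ => f p.2 := continuous_f.comp continuous_snd
    exact continuous_psi.comp (h1.prodMk h2)
  have h := intervalIntegral.continuous_parametric_intervalIntegral_of_continuous' hc 0 X
    (μ := volume)
  exact continuous_const.mul h

theorem tendsto_timeMean_schwartz
    (hLIC : LinearIndependent ℚ (fun γ : zetaOrdinates => (γ : ℝ))) (φ : 𝓢(ℂ, ℂ)) :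
    Tendsto (timeMean fun α => φ (f α)) atTop (𝓝 (∫ w, φ w * density w)) := by
  -- Self-adjointness of the Fourier transform moves it from `M̃` onto `φ`; the convergence of
  -- character means then passes under the integral, dominated by `‖𝓕 φ‖`.
  have h1 : ∫ w, φ w * density w = ∫ v : ℂ, scaledMTilde v * 𝓕 φ v := by
    have := VectorFourier.integral_fourierIntegral_smul_eq_flip (L := innerₗ ℂ) (μ := volume)
      (ν := volume) Real.continuous_fourierChar continuous_inner φ.integrable
      (integrable_scaledMTilde hLIC)
    rw [flip_innerₗ] at this
    simp_rw [mul_comm (scaledMTilde _)]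
    exact this.symm
  rw [h1]
  set ψ : 𝓢(ℂ, ℂ) := 𝓕 φ with hψ
  change Tendsto _ _ (𝓝 (∫ v : ℂ, scaledMTilde v * ψ v))
  have h2 : Tendsto (fun X => ∫ v : ℂ, timeMean (fun α => psi ((2 * Real.pi) • v) (f α)) X * ψ v)
      atTop (𝓝 (∫ v : ℂ, scaledMTilde v * ψ v)) := by
    refine tendsto_integral_filter_of_dominated_convergence (fun v => ‖ψ v‖) ?_ ?_
      ψ.integrable.norm ?_
    · exact Eventually.of_forall fun X =>
        ((continuous_timeMean_psi X).mul ψ.continuous).aestronglyMeasurable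
    · filter_upwards [eventually_gt_atTop 0] with X hX
      refine Eventually.of_forall fun v => ?_
      rw [norm_mul]
      exact mul_le_of_le_one_left (norm_nonneg _) (norm_timeMean_le hX fun α => by simp)
    · exact Eventually.of_forall fun v => (tendsto_timeMean_psi_f hLIC _).mul_const _
  refine h2.congr' ?_
  filter_upwards [eventually_gt_atTop 0] with X hX
  exact (timeMean_schwartz φ hX).symm

/-! ### Sign, support and total mass of the density -/

/-- A closed condition satisfied by the time means of all translates of bump functions is
satisfied by the values of the density. -/
lemma density_mem_of_timeMean_mem
    (hLIC : LinearIndependent ℚ (fun γ : zetaOrdinates => (γ : ℝ))) {s : Set ℂ}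
    (hs : IsClosed s) {w : ℂ} {ε : ℝ} (hε : 0 < ε)
    (H : ∀ g : ℂ → ℝ, Continuous g → (∀ x, 0 ≤ g x) → (∀ x, ε ≤ ‖w - x‖ → g x = 0) →
      ∀ X > 0, timeMean (fun α => (g (f α) : ℂ)) X ∈ s) : density w ∈ s := by
  -- Outer radii `ε / (n + 2)` tend to 0 and never exceed `ε`. Closedness of `s` is used twice: for
  -- the limit in `X`, then for the limit in `n`.
  set φ : ℕ → ContDiffBump (0 : ℂ) := fun n =>
    ⟨ε / (n + 2) / 2, ε / (n + 2), by positivity, half_lt_self (by positivity)⟩ with hφ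
  have hr : Tendsto (fun n => (φ n).rOut) atTop (𝓝 0) := by
    have : Tendsto (fun n : ℕ => ε / ((n : ℝ) + 2)) atTop (𝓝 0) :=
      Tendsto.const_div_atTop
        (tendsto_atTop_add_const_right _ _ tendsto_natCast_atTop_atTop) _
    exact this
  have hconv := ContDiffBump.convolution_tendsto_right_of_continuous (μ := volume) hr
    (continuous_density hLIC) w
  refine hs.mem_of_tendsto hconv (Eventually.of_forall fun n => ?_)
  set g : ℂ → ℝ := fun x => (φ n).normed volume (w - x) with hg
  have hgs : ContDiff ℝ (⊤ : ℕ∞) g := (φ n).contDiff_normed.comp (contDiff_const.sub contDiff_id)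
  have hgc : HasCompactSupport g :=
    (φ n).hasCompactSupport_normed.comp_homeomorph (Homeomorph.subLeft w)
  have hgsC : ContDiff ℝ (⊤ : ℕ∞) fun x => (g x : ℂ) := ofRealCLM.contDiff.comp hgs
  have hgcC : HasCompactSupport fun x => (g x : ℂ) := hgc.comp_left (g := ((↑) : ℝ → ℂ)) rfl
  have hlim := tendsto_timeMean_schwartz hLIC (hgcC.toSchwartzMap hgsC)
  have e : MeasureTheory.convolution ((φ n).normed volume) density
      (ContinuousLinearMap.lsmul ℝ ℝ) volume w =
      ∫ x, (hgcC.toSchwartzMap hgsC) x * density x := by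
    rw [MeasureTheory.convolution_eq_swap]
    rfl
  rw [e]
  refine hs.mem_of_tendsto hlim ?_
  filter_upwards [eventually_gt_atTop 0] with X hX
  refine H g hgs.continuous (fun x => (φ n).nonneg_normed _) (fun x hx => ?_) X hX
  have hsupp := (φ n).support_normed_eq (μ := volume)
  have : w - x ∉ Function.support ((φ n).normed volume) := by
    rw [hsupp]
    simp only [Metric.mem_ball, dist_zero_right, not_lt, hφ]
    refine le_trans (div_le_self hε.le ?_) hx
    have : (0 : ℝ) ≤ n := n.cast_nonneg
    linarith
  simpa using this

lemma density_nonneg (hLIC : LinearIndependent ℚ (fun γ : zetaOrdinates => (γ : ℝ))) (w : ℂ) :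
    0 ≤ (density w).re ∧ (density w).im = 0 := by
  have hs : IsClosed {z : ℂ | 0 ≤ z.re ∧ z.im = 0} :=
    (isClosed_le continuous_const continuous_re).inter
      (isClosed_eq continuous_im continuous_const)
  refine density_mem_of_timeMean_mem hLIC hs (w := w) one_pos fun g hg hg0 _ X hX => ?_
  have e : timeMean (fun α => (g (f α) : ℂ)) X = ((1 / X * ∫ α in (0 : ℝ)..X, g (f α) : ℝ) : ℂ) := by
    rw [timeMean, intervalIntegral.integral_ofReal]; push_cast; rfl
  rw [e]
  refine ⟨?_, ofReal_im _⟩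
  rw [ofReal_re]
  have := intervalIntegral.integral_nonneg hX.le (μ := volume) (f := fun α => g (f α))
    fun α _ => hg0 _
  positivity

/-- Values of `f` stay within `radius`, so bumps supported near such a `w` have zero time mean. -/
lemma density_eq_zero (hLIC : LinearIndependent ℚ (fun γ : zetaOrdinates => (γ : ℝ))) {w : ℂ}
    (hw : radius < ‖w‖) : density w = 0 := by
  refine density_mem_of_timeMean_mem hLIC (isClosed_singleton (x := (0 : ℂ))) (w := w)
    (sub_pos.2 hw) fun g _ _ hg X _ => ?_
  have h0 (α : ℝ) : g (f α) = 0 := hg _ (by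
    have h1 := norm_f_le α
    have h2 := norm_sub_norm_le w (f α)
    linarith)
  simp [timeMean, h0]

lemma hasCompactSupport_density
    (hLIC : LinearIndependent ℚ (fun γ : zetaOrdinates => (γ : ℝ))) : HasCompactSupport density :=
  HasCompactSupport.intro (isCompact_closedBall 0 radius) fun w hw =>
    density_eq_zero hLIC (by simpa using hw)

lemma integrable_density (hLIC : LinearIndependent ℚ (fun γ : zetaOrdinates => (γ : ℝ))) :
    Integrable density :=
  (continuous_density hLIC).integrable_of_hasCompactSupport (hasCompactSupport_density hLIC)

/-- Fourier inversion, available because compact support makes the density integrable. At `z = 0` it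
gives total mass 1. -/
lemma integral_psi_mul_density
    (hLIC : LinearIndependent ℚ (fun γ : zetaOrdinates => (γ : ℝ))) (z : ℂ) :
    ∫ w, psi z w * density w = MTilde z := by
  have h := Integrable.fourierInv_fourier_eq (integrable_scaledMTilde hLIC)
    (integrable_density hLIC) (continuous_scaledMTilde hLIC).continuousAt
    (v := (2 * Real.pi)⁻¹ • z)
  rw [Real.fourierInv_eq'] at h
  rw [scaledMTilde, smul_smul, mul_inv_cancel₀ Real.two_pi_pos.ne', one_smul] at h
  rw [← h]
  congr 1
  funext w
  rw [smul_eq_mul, psi_eq, mul_comm I, real_inner_smul_right, real_inner_comm, ← mul_assoc,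
    mul_inv_cancel₀ Real.two_pi_pos.ne', one_mul]
  rfl

lemma density_conj (w : ℂ) : density (starRingEnd ℂ w) = density w := by
  rw [density, Real.fourier_eq', Real.fourier_eq']
  have h := (conjLIE.measurePreserving (E := ℂ)).integral_comp
    conjLIE.toHomeomorph.measurableEmbedding
    fun v => exp (((-2 * Real.pi * inner ℝ v (starRingEnd ℂ w) : ℝ) : ℂ) * I) • scaledMTilde v
  rw [← h]
  congr 1
  funext v
  have h1 : inner ℝ (conjLIE v) (starRingEnd ℂ w) = inner ℝ v w := conjLIE.inner_map_map v w
  have h2 : scaledMTilde (conjLIE v) = scaledMTilde v := by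
    rw [scaledMTilde, ← map_smul]
    exact MTilde_conj _
  rw [h1, h2]

end GoldbachM

namespace GoldbachM

open Complex Set

/-! ### The limit distribution -/

lemma density_eq_re (hLIC : LinearIndependent ℚ (fun γ : zetaOrdinates => (γ : ℝ))) (w : ℂ) :
    ((density w).re : ℂ) = density w :=
  Complex.ext (by simp) (by simp [(density_nonneg hLIC w).2])

lemma integral_density (hLIC : LinearIndependent ℚ (fun γ : zetaOrdinates => (γ : ℝ))) :
    ∫ w, density w = 1 := by
  simpa [MTilde_zero] using integral_psi_mul_density hLIC 0

lemma integral_density_re (hLIC : LinearIndependent ℚ (fun γ : zetaOrdinates => (γ : ℝ))) :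
    ∫ w, (density w).re = 1 := by
  have h : ((∫ w, (density w).re : ℝ) : ℂ) = 1 := by
    rw [← integral_complex_ofReal, ← integral_density hLIC]
    simp_rw [density_eq_re hLIC]
  exact_mod_cast h

/-- The limit distribution of `f`. -/
noncomputable def limitLaw : Measure ℂ :=
  volume.withDensity fun w => ENNReal.ofReal (density w).re

lemma limitLaw_absolutelyContinuous : limitLaw ≪ volume := withDensity_absolutelyContinuous _ _

lemma isProbabilityMeasure_limitLaw
    (hLIC : LinearIndependent ℚ (fun γ : zetaOrdinates => (γ : ℝ))) :
    IsProbabilityMeasure limitLaw := by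
  refine ⟨?_⟩
  rw [limitLaw, withDensity_apply _ MeasurableSet.univ, Measure.restrict_univ,
    ← ofReal_integral_eq_lintegral_ofReal (f := fun w => (density w).re)
      (integrable_density hLIC).re (Eventually.of_forall fun w => (density_nonneg hLIC w).1),
    integral_density_re hLIC, ENNReal.ofReal_one]

lemma integral_limitLaw (hLIC : LinearIndependent ℚ (fun γ : zetaOrdinates => (γ : ℝ)))
    (Φ : ℂ → ℂ) : ∫ w, Φ w ∂limitLaw = ∫ w, density w * Φ w := by
  have hm : Measurable fun w => ENNReal.ofReal (density w).re :=
    ENNReal.measurable_ofReal.comp (continuous_re.comp (continuous_density hLIC)).measurable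
  rw [limitLaw, integral_withDensity_eq_integral_toReal_smul hm
    (Eventually.of_forall fun _ => ENNReal.ofReal_lt_top)]
  congr 1
  funext w
  rw [ENNReal.toReal_ofReal (density_nonneg hLIC w).1, Complex.real_smul, density_eq_re hLIC]

lemma charFun_limitLaw (hLIC : LinearIndependent ℚ (fun γ : zetaOrdinates => (γ : ℝ))) (z : ℂ) :
    charFun limitLaw z = MTilde z := by
  rw [charFun_apply, integral_limitLaw hLIC, ← integral_psi_mul_density hLIC z]
  congr 1
  funext w
  rw [psi_eq, mul_comm, mul_comm I, real_inner_comm]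

/-- The distribution of `f` on `(0, X]`. -/
noncomputable def law (X : ℝ) : Measure ℂ :=
  ((ENNReal.ofReal X)⁻¹ • volume.restrict (Ioc 0 X)).map f

lemma isProbabilityMeasure_law {X : ℝ} (hX : 0 < X) : IsProbabilityMeasure (law X) := by
  have h : IsProbabilityMeasure ((ENNReal.ofReal X)⁻¹ • volume.restrict (Ioc 0 X)) := by
    refine ⟨?_⟩
    rw [Measure.smul_apply, Measure.restrict_apply_univ, Real.volume_Ioc, sub_zero, smul_eq_mul,
      ENNReal.inv_mul_cancel (by simpa using hX) ENNReal.ofReal_ne_top]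
  exact Measure.isProbabilityMeasure_map continuous_f.measurable.aemeasurable

lemma integral_law {X : ℝ} (hX : 0 < X) {Φ : ℂ → ℂ} (hΦ : StronglyMeasurable Φ) :
    ∫ w, Φ w ∂law X = timeMean (fun α => Φ (f α)) X := by
  rw [law, integral_map continuous_f.measurable.aemeasurable hΦ.aestronglyMeasurable,
    integral_smul_measure, timeMean, intervalIntegral.integral_of_le hX.le, ENNReal.toReal_inv,
    ENNReal.toReal_ofReal hX.le, Complex.real_smul]
  push_cast
  rw [one_div]

lemma charFun_law {X : ℝ} (hX : 0 < X) (z : ℂ) :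
    charFun (law X) z = timeMean (fun α => psi z (f α)) X := by
  have hc : Continuous fun w => psi z w :=
    continuous_psi.comp (continuous_const.prodMk continuous_id)
  rw [charFun_apply, ← integral_law hX hc.stronglyMeasurable]
  congr 1
  funext w
  rw [psi_eq, mul_comm I, real_inner_comm]

/-- `law`, as a probability measure for all `X`. -/
noncomputable def lawProb (X : ℝ) : ProbabilityMeasure ℂ :=
  ⟨law (max X 1), isProbabilityMeasure_law (by positivity)⟩

theorem tendsto_lawProb (hLIC : LinearIndependent ℚ (fun γ : zetaOrdinates => (γ : ℝ))) :
    Tendsto lawProb atTop (𝓝 ⟨limitLaw, isProbabilityMeasure_limitLaw hLIC⟩) := by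
  -- Lévy's continuity theorem is applied along sequences; the cap `max X 1` in `lawProb` does not
  -- affect the limit.
  refine tendsto_of_seq_tendsto fun u hu => ?_
  refine ProbabilityMeasure.tendsto_iff_tendsto_charFun.2 fun z => ?_
  change Tendsto (fun n => charFun (law (max (u n) 1)) z) atTop (𝓝 (charFun limitLaw z))
  rw [charFun_limitLaw hLIC]
  have h (n : ℕ) : charFun (law (max (u n) 1)) z =
      timeMean (fun α => psi z (f α)) (max (u n) 1) := charFun_law (by positivity) z
  simp_rw [h]
  exact (tendsto_timeMean_psi_f hLIC z).comp
    (tendsto_atTop_mono (fun n => le_max_left (u n) 1) hu)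

/-! ### Test functions -/

lemma tendsto_timeMean_boundedContinuous
    (hLIC : LinearIndependent ℚ (fun γ : zetaOrdinates => (γ : ℝ)))
    (Φ : BoundedContinuousFunction ℂ ℂ) :
    Tendsto (timeMean fun α => Φ (f α)) atTop (𝓝 (∫ w, density w * Φ w)) := by
  have h := (ProbabilityMeasure.tendsto_iff_forall_integral_rclike_tendsto ℂ).1
    (tendsto_lawProb hLIC) Φ
  rw [← integral_limitLaw hLIC]
  refine h.congr' ?_
  filter_upwards [eventually_ge_atTop 1] with X hX
  change ∫ w, Φ w ∂law (max X 1) = _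
  rw [max_eq_left hX, integral_law (by linarith) Φ.continuous.stronglyMeasurable]

lemma tendsto_timeMean_continuous
    (hLIC : LinearIndependent ℚ (fun γ : zetaOrdinates => (γ : ℝ))) {Φ : ℂ → ℂ}
    (hΦ : Continuous Φ) :
    Tendsto (timeMean fun α => Φ (f α)) atTop (𝓝 (∫ w, density w * Φ w)) := by
  -- The cutoff equals 1 on a disc containing all values of `f` and the support of the density, so
  -- multiplying `Φ` by it changes neither side and makes it bounded.
  obtain ⟨χ, hχ1, -, hχc, -⟩ := exists_continuous_one_zero_of_isCompact
    (isCompact_closedBall (0 : ℂ) radius) isClosed_empty (disjoint_empty _)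
  have hΨc : Continuous fun w => (χ w : ℂ) * Φ w := by fun_prop
  have hΨs : HasCompactSupport fun w => (χ w : ℂ) * Φ w := by
    refine HasCompactSupport.mul_right ?_
    exact hχc.comp_left (g := ((↑) : ℝ → ℂ)) rfl
  obtain ⟨C, hC⟩ := hΨc.bounded_above_of_compact_support hΨs
  have h := tendsto_timeMean_boundedContinuous hLIC
    (BoundedContinuousFunction.ofNormedAddCommGroup _ hΨc C hC)
  have hχ (w : ℂ) (hw : ‖w‖ ≤ radius) : χ w = 1 := hχ1 (by simpa using hw)
  have e1 : ∫ w, density w * Φ w = ∫ w, density w * ((χ w : ℂ) * Φ w) := by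
    congr 1
    funext w
    rcases le_or_gt ‖w‖ radius with hw | hw
    · rw [hχ w hw]; simp
    · rw [density_eq_zero hLIC hw]; simp
  rw [e1]
  refine h.congr fun X => ?_
  congr 1
  funext α
  simp [hχ _ (norm_f_le α)]

/-- Portmanteau: the limit law has a density, so a Lebesgue-null frontier is null for it. -/
lemma tendsto_timeMean_indicator
    (hLIC : LinearIndependent ℚ (fun γ : zetaOrdinates => (γ : ℝ))) {A : Set ℂ}
    (hA : MeasurableSet A) (hfr : volume (frontier A) = 0) :
    Tendsto (timeMean fun α => A.indicator (fun _ => (1 : ℂ)) (f α)) atTop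
      (𝓝 (∫ w, density w * A.indicator (fun _ => (1 : ℂ)) w)) := by
  have hPM := isProbabilityMeasure_limitLaw hLIC
  have h0 : limitLaw (frontier A) = 0 := limitLaw_absolutelyContinuous hfr
  have h := ProbabilityMeasure.tendsto_measure_of_null_frontier_of_tendsto (tendsto_lawProb hLIC)
    (E := A) ((ProbabilityMeasure.null_iff_toMeasure_null _ _).2 h0)
  have h' : Tendsto (fun X => (((lawProb X : Measure ℂ).real A : ℝ) : ℂ)) atTop
      (𝓝 ((limitLaw.real A : ℝ) : ℂ)) :=
    (continuous_ofReal.tendsto _).comp ((NNReal.continuous_coe.tendsto _).comp h)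
  have hind (μ : Measure ℂ) : ∫ w, A.indicator (fun _ => (1 : ℂ)) w ∂μ = ((μ.real A : ℝ) : ℂ) := by
    rw [integral_indicator_const _ hA]; simp
  rw [← integral_limitLaw hLIC, hind]
  refine h'.congr' ?_
  filter_upwards [eventually_ge_atTop 1] with X hX
  change (((law (max X 1)).real A : ℝ) : ℂ) = _
  rw [max_eq_left hX, ← hind, integral_law (by linarith)
    (stronglyMeasurable_const.indicator hA)]

lemma IsTestFunction.tendsto_timeMean
    (hLIC : LinearIndependent ℚ (fun γ : zetaOrdinates => (γ : ℝ))) {Φ : ℂ → ℂ}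
    (hΦ : IsTestFunction Φ) :
    Tendsto (timeMean fun α => Φ (f α)) atTop (𝓝 (∫ w, density w * Φ w)) := by
  rcases hΦ with hΦ | ⟨A, hA, hfr, rfl | rfl⟩
  · exact tendsto_timeMean_continuous hLIC hΦ
  · exact tendsto_timeMean_indicator hLIC hA.measurableSet hfr
  · exact tendsto_timeMean_indicator hLIC hA.measurableSet.compl (by rwa [frontier_compl])

lemma IsTestFunction.measurable {Φ : ℂ → ℂ} (hΦ : IsTestFunction Φ) : Measurable Φ := by
  rcases hΦ with hΦ | ⟨A, hA, -, rfl | rfl⟩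
  · exact hΦ.measurable
  · exact measurable_const.indicator hA.measurableSet
  · exact measurable_const.indicator hA.measurableSet.compl

lemma IsTestFunction.exists_norm_le {Φ : ℂ → ℂ} (hΦ : IsTestFunction Φ) :
    ∃ C : ℝ, ∀ w, ‖w‖ ≤ radius → ‖Φ w‖ ≤ C := by
  rcases hΦ with hΦ | ⟨A, -, -, rfl | rfl⟩
  · obtain ⟨C, hC⟩ := (isCompact_closedBall (0 : ℂ) radius).exists_bound_of_continuousOn
      hΦ.continuousOn
    exact ⟨C, fun w hw => hC w (by simpa using hw)⟩
  all_goals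
    refine ⟨1, fun w _ => (norm_indicator_le_norm_self _ _).trans ?_⟩
    simp

lemma IsTestFunction.intervalIntegrable {Φ : ℂ → ℂ} (hΦ : IsTestFunction Φ) (X Y : ℝ) :
    IntervalIntegrable (fun α => Φ (f α)) volume X Y := by
  obtain ⟨C, hC⟩ := hΦ.exists_norm_le
  refine (intervalIntegrable_const (c := C)).mono_fun'
    (hΦ.measurable.comp continuous_f.measurable).aestronglyMeasurable ?_
  exact Eventually.of_forall fun α => hC _ (norm_f_le α)

lemma IsTestFunction.integrable_density_mul
    (hLIC : LinearIndependent ℚ (fun γ : zetaOrdinates => (γ : ℝ))) {Φ : ℂ → ℂ}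
    (hΦ : IsTestFunction Φ) : Integrable fun w => density w * Φ w := by
  obtain ⟨C, hC⟩ := hΦ.exists_norm_le
  refine ((integrable_density hLIC).norm.mul_const C).mono'
    ((continuous_density hLIC).measurable.mul hΦ.measurable).aestronglyMeasurable ?_
  refine Eventually.of_forall fun w => ?_
  rcases le_or_gt ‖w‖ radius with hw | hw
  · rw [norm_mul]
    exact mul_le_mul_of_nonneg_left (hC w hw) (norm_nonneg _)
  · simp [density_eq_zero hLIC hw]

end GoldbachM

theorem mainTheorem1
    (hLIC : LinearIndependent ℚ (fun γ : GoldbachM.zetaOrdinates => (γ : ℝ))) :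
    -- the series and the product defining `f` and `M` converge absolutely
    (∀ α : ℝ, Summable (fun γ : GoldbachM.zetaOrdinates => ‖GoldbachM.fTerm α γ‖)) ∧
    (∀ z : ℂ, Multipliable
      (fun γ : GoldbachM.zetaOrdinates => GoldbachM.circleFourier (GoldbachM.c γ) z)) ∧
    Integrable GoldbachM.MTilde GoldbachM.dw ∧
    ∃ M : ℂ → ℝ,
      (∀ w : ℂ, (M w : ℂ) = GoldbachM.MInt w) ∧
      (∀ w : ℂ, 0 ≤ M w) ∧
      Continuous M ∧
      Tendsto M (cocompact ℂ) (𝓝 0) ∧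
      (∀ w : ℂ, M (starRingEnd ℂ w) = M w) ∧
      Integrable M GoldbachM.dw ∧
      ∫ w, M w ∂GoldbachM.dw = 1 ∧
      ∀ Φ : ℂ → ℂ, GoldbachM.IsTestFunction Φ →
        (∀ X : ℝ, IntervalIntegrable (fun α => Φ (GoldbachM.f α)) volume 0 X) ∧
        Integrable (fun w => (M w : ℂ) * Φ w) GoldbachM.dw ∧
        Tendsto
          (fun X : ℝ => (1 / X : ℂ) * ∫ α in (0 : ℝ)..X, Φ (GoldbachM.f α))
          atTop
          (𝓝 (∫ w, (M w : ℂ) * Φ w ∂GoldbachM.dw)) := by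
  have hMC (w : ℂ) : ((2 * Real.pi * (GoldbachM.density w).re : ℝ) : ℂ) =
      (2 * Real.pi : ℂ) * GoldbachM.density w := by
    push_cast
    rw [GoldbachM.density_eq_re hLIC]
  have hcont : Continuous fun w => 2 * Real.pi * (GoldbachM.density w).re :=
    continuous_const.mul (Complex.continuous_re.comp (GoldbachM.continuous_density hLIC))
  have hsupp : HasCompactSupport fun w => 2 * Real.pi * (GoldbachM.density w).re :=
    HasCompactSupport.mul_left ((GoldbachM.hasCompactSupport_density hLIC).comp_left
      (g := Complex.re) rfl)
  refine ⟨fun α => by simpa only [GoldbachM.norm_fTerm] using GoldbachM.summable_c,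
    GoldbachM.multipliable_circleFourier,
    GoldbachM.integrable_dw
      (GoldbachM.integrable_MTilde_of_continuous (GoldbachM.continuous_MTilde hLIC)),
    fun w => 2 * Real.pi * (GoldbachM.density w).re, fun w => ?_, fun w => ?_, hcont,
    hsupp.is_zero_at_infty, fun w => by simp only [GoldbachM.density_conj],
    GoldbachM.integrable_dw (hcont.integrable_of_hasCompactSupport hsupp), ?_,
    fun Φ hΦ => ⟨fun X => hΦ.intervalIntegrable 0 X, ?_, ?_⟩⟩
  · rw [hMC, GoldbachM.MInt_eq, Complex.real_smul]
    push_cast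
    rfl
  · have := (GoldbachM.density_nonneg hLIC w).1
    positivity
  · rw [GoldbachM.integral_dw, integral_const_mul, GoldbachM.integral_density_re hLIC,
      smul_eq_mul, mul_one,
      one_div, inv_mul_cancel₀ Real.two_pi_pos.ne']
  · simp_rw [hMC, mul_assoc]
    have h := (hΦ.integrable_density_mul hLIC).const_mul (2 * Real.pi : ℂ)
    simp_rw [mul_assoc] at h
    exact GoldbachM.integrable_dw h
  · have h := hΦ.tendsto_timeMean hLIC
    have e : ∫ w, ((2 * Real.pi * (GoldbachM.density w).re : ℝ) : ℂ) * Φ w ∂GoldbachM.dw =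
        ∫ w, GoldbachM.density w * Φ w := by
      simp_rw [hMC, mul_assoc (2 * Real.pi : ℂ)]
      rw [GoldbachM.integral_dw, integral_const_mul, Complex.real_smul, ← mul_assoc]
      push_cast
      rw [one_div, inv_mul_cancel₀ (by simp), one_mul]
    rw [e]
    exact h
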